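/- Let $\mathcal S,\mathcal A$ be finite sets, $S=|\mathcal S|$, $A=|\mathcal A|$, and consider an episodic constrained MDP with horizon $H$, fixed initial state $s^1$, transition function $P(s'|s,a)$, costs $r,c:\mathcal S\times\mathcal A\to[0,1]$ and constraint level $\bar C$. A policy is $\pi=(\pi^h)_{h=1}^H$ with $\pi^h(s,\cdot)$ a probability vector on $\mathcal A$. For a transition function $P'$ and $l:\mathcal S\times\mathcal A\to\mathbb R$ let $V_l^\pi(P')=\mathbb E[\sum_{h=1}^H l(s^h,a^h)]$ and $w^h_\pi(s,a;P')=\mathbb P(s^h=s,a^h=a)$ for the episode generated from $s^1$ by $\pi$ and $P'$. Let $\pi^*$ be an optimal safe policy, i.e. a minimizer of $V_r^\pi(P)$ over the policies with $V_c^\pi(P)\le\bar C$, and let $\pi_b$ be a baseline policy with $V_c^{\pi_b}(P)=\bar C_b<\bar C$, where $\bar C-\bar C_b\le H$. Fix $\delta\in(0,1)$ and a number $K$ of episodes, and put $L=\log(2SAHK/\delta)$. Let $n_k(s,a)$ and $n_k(s,a,s')$ be the numbers of visits to $(s,a)$ and of transitions from $(s,a)$ to $s'$ in episodes $1,\dots,k-1$,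 let $\widehat P_k(s'|s,a)=n_k(s,a,s')/(n_k(s,a)\vee1)$, $$\beta_k(s,a,s')=\sqrt{\frac{4\widehat P_k(s'|s,a)(1-\widehat P_k(s'|s,a))L}{n_k(s,a)\vee1}}+\frac{14L}{3(n_k(s,a)\vee1)},\qquad \bar\beta_k(s,a)=\sum_{s'}\beta_k(s,a,s'),$$ and let $\mathcal P_k$ be the set of transition functions $P'$ with $|P'(s'|s,a)-\widehat P_k(s'|s,a)|\le\beta_k(s,a,s')$ for all $s,a,s'$. Put $c_k=c+H\bar\beta_k$ and $r_k=r-\frac{H^2}{\bar C-\bar C_b}\bar\beta_k$. The OP problem of episode $k$ is to minimize $V_{r_k}^{\pi'}(P')$ over pairs $(\pi',P')$ with $P'\in\mathcal P_k$ and $V_{c_k}^{\pi'}(P')\le\bar C$; pairs that satisfy these constraints are called feasible. The OPSRL algorithm with parameter $K_o$ plays $\pi_b$ in the episodes $k\le K_o$, and in every episode $k>K_o$ the policy of an optimal solution of the OP problem of that episode (an arbitrary policy if that problem is infeasible). Then $K_o=\tilde{\mathcal O}\big(\frac{S^2AH^3}{(\bar C-\bar C_b)^2}\big)$ can be chosen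 such that, with probability at least $1-3\delta$ over the $K$ episodes of OPSRL, the following holds for every $k\in\{1,\dots,K\}$ with $k\ge K_o$: there is a policy $\pi'$ such that $(\pi',P)$ is feasible for the OP problem of episode $k$, such that $w^h_{\pi'}(s,a;P)>0$ for every $(s,a,h)$ with $w^h_{\pi^*}(s,a;P)>0$, and such that $w_{\pi'}(\cdot;P)=(1-\alpha)\,w_{\pi_b}(\cdot;P)+\alpha\,w_{\pi^*}(\cdot;P)$ for some $\alpha\in(0,1)$. More precisely, there are universal constants $C>0$ and $p\in\mathbb N$ such that this holds for every integer $K_o\ge C\,L^p\,\frac{S^2AH^3}{(\bar C-\bar C_b)^2}$. -/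

import Mathlib

namespace OPSRL

/-- A non-stationary randomized policy with horizon `H`: `prob h s a` is the probability of taking
action `a` in state `s` at time step `h` (steps are indexed from `0`). -/
structure Policy (S A : Type*) [Fintype A] (H : ℕ) where
  prob : Fin H → S → A → ℝ
  nonneg : ∀ h s a, 0 ≤ prob h s a
  sum_eq_one : ∀ h s, ∑ a, prob h s a = 1

/-- A transition probability function: `prob s a s'` is `P(s' | s, a)`. -/
structure Model (S A : Type*) [Fintype S] where
  prob : S → A → S → ℝ
  nonneg : ∀ s a s', 0 ≤ prob s a s'
  sum_eq_one : ∀ s a, ∑ s', prob s a s' = 1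

/-- A finite episodic constrained MDP with horizon `H`, true model `P`, objective cost `r`,
constraint cost `c` (both with values in `[0,1]`), constraint level `Cbar` and fixed initial
state `s₁`. -/
structure CMDP (S A : Type*) [Fintype S] (H : ℕ) where
  P : Model S A
  r : S → A → ℝ
  c : S → A → ℝ
  r_mem : ∀ s a, r s a ∈ Set.Icc (0 : ℝ) 1
  c_mem : ∀ s a, c s a ∈ Set.Icc (0 : ℝ) 1
  Cbar : ℝ
  s₁ : S

/-- The trajectory of one episode: the states `s^1, …, s^{H+1}` and the actions `a^1, …, a^H`. -/
abbrev Episode (S A : Type*) (H : ℕ) : Type _ := (Fin (H + 1) → S) × (Fin H → A)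

section Planning

variable {S A : Type*} [Fintype S] [Fintype A] [DecidableEq S] {H : ℕ}

/-- The probability that an episode that starts in `s₁` and is played with the policy `π` in the
model `P` has the trajectory `τ`. -/
def trajProb (P : Model S A) (s₁ : S) (π : Policy S A H) (τ : Episode S A H) : ℝ :=
  (if τ.1 0 = s₁ then 1 else 0) *
    ∏ h : Fin H, (π.prob h (τ.1 h.castSucc) (τ.2 h) *
      P.prob (τ.1 h.castSucc) (τ.2 h) (τ.1 h.succ))

/-- The value `V_l^π(P) = E[∑_h l(s^h, a^h)]` of the policy `π` in the model `P`, from `s₁`. -/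
def value (P : Model S A) (s₁ : S) (π : Policy S A H) (l : S → A → ℝ) : ℝ :=
  ∑ τ : Episode S A H, trajProb P s₁ π τ * ∑ h : Fin H, l (τ.1 h.castSucc) (τ.2 h)

/-- The occupancy measure `w_π^h(s, a; P)`: the probability that `s^h = s` and `a^h = a`. -/
noncomputable def occupancy (P : Model S A) (s₁ : S) (π : Policy S A H)
    (h : Fin H) (s : S) (a : A) : ℝ :=
  ∑ τ : Episode S A H,
    Set.indicator {τ | τ.1 h.castSucc = s ∧ τ.2 h = a} (trajProb P s₁ π) τ

/-- The policies that satisfy the constraint in the true model. -/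
def safePolicies (M : CMDP S A H) : Set (Policy S A H) :=
  {π | value M.P M.s₁ π M.c ≤ M.Cbar}

/-- `π` is an optimal safe policy, a solution of the CMDP planning problem. -/
def IsOptimalSafe (M : CMDP S A H) (π : Policy S A H) : Prop :=
  π ∈ safePolicies M ∧ ∀ π' ∈ safePolicies M, value M.P M.s₁ π M.r ≤ value M.P M.s₁ π' M.r

end Planning

section Learning

variable {S A : Type*} [Fintype S] [Fintype A] [DecidableEq S] [DecidableEq A] {H : ℕ}

/-- `n(s, a)`: the number of visits to `(s, a)` in the `m` past episodes `hist`. -/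
def visits {m : ℕ} (hist : Fin m → Episode S A H) (s : S) (a : A) : ℕ :=
  ∑ j : Fin m, ∑ h : Fin H, if (hist j).1 h.castSucc = s ∧ (hist j).2 h = a then 1 else 0

/-- `n(s, a, s')`: the number of observed transitions from `(s, a)` to `s'` in `hist`. -/
def transitions {m : ℕ} (hist : Fin m → Episode S A H) (s : S) (a : A) (s' : S) : ℕ :=
  ∑ j : Fin m, ∑ h : Fin H,
    if (hist j).1 h.castSucc = s ∧ (hist j).2 h = a ∧ (hist j).1 h.succ = s' then 1 else 0

/-- The empirical model `n(s, a, s') / (n(s, a) ∨ 1)`. -/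
noncomputable def empModel {m : ℕ} (hist : Fin m → Episode S A H) (s : S) (a : A) (s' : S) : ℝ :=
  (transitions hist s a s' : ℝ) / (max (visits hist s a) 1 : ℕ)

/-- `L = log (2 S A H K / δ)`. -/
noncomputable def logTerm (S A : Type*) [Fintype S] [Fintype A] (H K : ℕ) (δ : ℝ) : ℝ :=
  Real.log (2 * Fintype.card S * Fintype.card A * H * K / δ)

/-- The confidence radius `β(s, a, s')`, with logarithmic factor `L`. -/
noncomputable def beta (L : ℝ) {m : ℕ} (hist : Fin m → Episode S A H) (s : S) (a : A) (s' : S) :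
    ℝ :=
  Real.sqrt (4 * (empModel hist s a s' * (1 - empModel hist s a s')) * L /
      (max (visits hist s a) 1 : ℕ)) +
    14 * L / (3 * (max (visits hist s a) 1 : ℕ))

/-- `β̄(s, a) = ∑_{s'} β(s, a, s')`. -/
noncomputable def betaBar (L : ℝ) {m : ℕ} (hist : Fin m → Episode S A H) (s : S) (a : A) : ℝ :=
  ∑ s' : S, beta L hist s a s'

/-- The confidence set of models around the empirical model. -/
def confidenceSet (L : ℝ) {m : ℕ} (hist : Fin m → Episode S A H) : Set (Model S A) :=
  {P' | ∀ s a s', |P'.prob s a s' - empModel hist s a s'| ≤ beta L hist s a s'}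

/-- The pessimistic constraint cost `c + H β̄`. -/
noncomputable def pessCost (M : CMDP S A H) (L : ℝ) {m : ℕ} (hist : Fin m → Episode S A H)
    (s : S) (a : A) : ℝ :=
  M.c s a + H * betaBar L hist s a

/-- The optimistic objective cost `r - H² / (C̄ - C̄_b) β̄`. -/
noncomputable def optCost (M : CMDP S A H) (Cb L : ℝ) {m : ℕ} (hist : Fin m → Episode S A H)
    (s : S) (a : A) : ℝ :=
  M.r s a - (H : ℝ) ^ 2 / (M.Cbar - Cb) * betaBar L hist s a

/-- The feasible pairs `(π', P')` of the Optimistic-Pessimistic problem after the past episodes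
`hist`. -/
def opFeasible (M : CMDP S A H) (L : ℝ) {m : ℕ} (hist : Fin m → Episode S A H) :
    Set (Policy S A H × Model S A) :=
  {x | x.2 ∈ confidenceSet L hist ∧ value x.2 M.s₁ x.1 (pessCost M L hist) ≤ M.Cbar}

/-- `x = (π', P')` is an optimal solution of the Optimistic-Pessimistic problem. -/
def IsOPSolution (M : CMDP S A H) (Cb L : ℝ) {m : ℕ} (hist : Fin m → Episode S A H)
    (x : Policy S A H × Model S A) : Prop :=
  x ∈ opFeasible M L hist ∧ ∀ y ∈ opFeasible M L hist,
    value x.2 M.s₁ x.1 (optCost M Cb L hist) ≤ value y.2 M.s₁ y.1 (optCost M Cb L hist)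

/-- A learning algorithm: the policy for episode `m + 1`, given the `m` past episodes. -/
abbrev Algorithm (S A : Type*) [Fintype A] (H : ℕ) : Type _ :=
  (m : ℕ) → (Fin m → Episode S A H) → Policy S A H

/-- `alg` is an instance of the OPSRL algorithm: it plays the baseline policy `πb` in the first
`K₀` episodes, and after that the policy of an optimal solution of the Optimistic-Pessimistic
problem (any policy, if that problem has no feasible point). -/
def IsOPSRL (M : CMDP S A H) (πb : Policy S A H) (Cb L : ℝ) (K₀ : ℕ)
    (alg : Algorithm S A H) : Prop :=
  ∀ (m : ℕ) (hist : Fin m → Episode S A H),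
    (m + 1 ≤ K₀ → alg m hist = πb) ∧
    (K₀ < m + 1 → (opFeasible M L hist).Nonempty →
      ∃ P' : Model S A, IsOPSolution M Cb L hist (alg m hist, P'))

/-- The episodes of the run `ω` that precede its episode number `k + 1`. -/
def past {K : ℕ} (ω : Fin K → Episode S A H) (k : Fin K) : Fin (k : ℕ) → Episode S A H :=
  fun j => ω (j.castLE k.isLt.le)

/-- The probability that `K` episodes of the algorithm `alg` in the true model produce the
run `ω`. -/
def runWeight (M : CMDP S A H) (alg : Algorithm S A H) {K : ℕ} (ω : Fin K → Episode S A H) : ℝ :=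
  ∏ k : Fin K, trajProb M.P M.s₁ (alg k (past ω k)) (ω k)

/-- The probability of the event `E` under the law of the first `K` episodes of `alg`. -/
noncomputable def runProb (M : CMDP S A H) (alg : Algorithm S A H) {K : ℕ}
    (E : Set (Fin K → Episode S A H)) : ℝ :=
  ∑ ω : Fin K → Episode S A H, E.indicator (runWeight M alg) ω

end Learning

end OPSRL

/-! Write `Δ = C̄ - C̄_b`, and let `w(s,a)` be the expected number of visits of the baseline policy
to `(s,a)` in one episode. Values are linear in occupancy measures and the occupancy measures of a
fixed model form a convex set (`exists_policy_occupancy_convex`). So once the baseline satisfies the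
pessimistic constraint strictly under `P`, mixing in a small amount of the optimal safe policy
preserves the constraint and gives the required support (`exists_mixture_value_le`). It remains to
show two things with high probability: `P` lies in the confidence sets, and the baseline keeps
slack, that is `H ∑ w β̄ < Δ`.

Slack: about `m` baseline episodes give at least `m w / 2 - H L` visits to each pair. Since `β̄` is
of order `√(L S / n)`, the term `w β̄` is of order `√(L S w / m)`. Cauchy–Schwarz over the pairs,
with `∑ w = H`, gives `√(L S² A H / m)`. After multiplication by `H` this is below `Δ` once `m` is
of order `L S² A H³ / Δ²`; the lower-order terms raise the power of `L` to 2 (`mul_bonus_le`,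
`sum_mul_betaBar_lt`).

Probability: every bad event is witnessed by a nonnegative weight `Z` on runs that is at least 1 on
bad runs and has a small expectation. Such weights are rescaled sums of exponential
supermartingales, so adding them replaces the union bound and Markov's inequality finishes
(`sum_runWeight_mul_le`, `one_sub_le_runProb`). For the confidence sets the supermartingale is a
Bernstein product stopped at the `n`-th visit to `(s,a)`. The union then runs over visit counts, and
the adaptivity of the algorithm does no harm (`exists_bernstein_weight`,
`exists_confidence_weight`). For the visits it is a product over the baseline episodes
(`exists_visits_weight`). -/

namespace OPSRL

/-! ### Expectations over one episode -/

section Trajectories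

variable {S A : Type*} [Fintype S] [Fintype A] {H : ℕ}

/-- The policy for the remaining steps, after the first one. -/
def Policy.tail (π : Policy S A (H + 1)) : Policy S A H where
  prob h := π.prob h.succ
  nonneg h := π.nonneg h.succ
  sum_eq_one h := π.sum_eq_one h.succ

variable [DecidableEq S]

/-- The expectation of `f` over the trajectory of one episode. -/
def trajExp (P : Model S A) (s₁ : S) (π : Policy S A H) (f : Episode S A H → ℝ) : ℝ :=
  ∑ τ, trajProb P s₁ π τ * f τ

theorem trajProb_nonneg (P : Model S A) (s₁ : S) (π : Policy S A H) (τ : Episode S A H) :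
    0 ≤ trajProb P s₁ π τ := by
  unfold trajProb
  refine mul_nonneg (by split_ifs <;> norm_num) (Finset.prod_nonneg fun h _ => ?_)
  exact mul_nonneg (π.nonneg _ _ _) (P.nonneg _ _ _)

theorem trajProb_cons (P : Model S A) (s₁ : S) (π : Policy S A (H + 1)) (s : S) (a : A)
    (σ : Fin (H + 1) → S) (α : Fin H → A) :
    trajProb P s₁ π ((Fin.cons s σ : Fin (H + 2) → S), (Fin.cons a α : Fin (H + 1) → A)) =
      (if s = s₁ then 1 else 0) * (π.prob 0 s a * P.prob s a (σ 0) *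
        ∏ h : Fin H, (π.tail.prob h (σ h.castSucc) (α h) *
          P.prob (σ h.castSucc) (α h) (σ h.succ))) := by
  unfold trajProb
  rw [Fin.prod_univ_succ]
  simp [Policy.tail]

/-- Conditioning on the first action and the first transition. This recursion drives the inductions
on the horizon. -/
theorem trajExp_succ (P : Model S A) (s₁ : S) (π : Policy S A (H + 1))
    (f : Episode S A (H + 1) → ℝ) :
    trajExp P s₁ π f = ∑ a, π.prob 0 s₁ a * ∑ s', P.prob s₁ a s' *
      trajExp P s' π.tail (fun τ => f ((Fin.cons s₁ τ.1 : Fin (H + 2) → S),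
        (Fin.cons a τ.2 : Fin (H + 1) → A))) := by
  unfold trajExp
  rw [Fintype.sum_prod_type, ← (Fin.consEquiv (fun _ => S)).sum_comp, Fintype.sum_prod_type]
  simp_rw [← (Fin.consEquiv (fun _ => A)).sum_comp, Fintype.sum_prod_type]
  simp only [Fin.consEquiv, Equiv.coe_fn_mk, trajProb_cons]
  refine (Finset.sum_eq_single s₁ (by intro b _ hb; simp [hb]) (by simp)).trans ?_
  rw [Finset.sum_comm]
  refine Finset.sum_congr rfl fun a _ => ?_
  simp_rw [Finset.mul_sum]
  refine Eq.trans ?_ Finset.sum_comm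
  refine Finset.sum_congr rfl fun σ _ => ?_
  refine Eq.trans ?_ Finset.sum_comm
  refine Finset.sum_congr rfl fun α _ => ?_
  -- A trajectory started in `s'` has weight zero unless its first state is `s'`, so the sum over
  -- `s'` collapses to `σ 0`.
  refine Eq.symm ((Finset.sum_eq_single (σ 0)
    (by intro b _ hb; simp [trajProb, hb.symm]) (by simp)).trans ?_)
  simp [trajProb]
  ring

theorem trajExp_zero (P : Model S A) (s₁ : S) (π : Policy S A 0) (f : Episode S A 0 → ℝ) :
    trajExp P s₁ π f = f (fun _ => s₁, Fin.elim0) := by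
  unfold trajExp
  rw [Finset.sum_eq_single (fun _ => s₁, Fin.elim0)]
  · simp [trajProb]
  · intro τ _ hτ
    have : τ.1 0 ≠ s₁ := fun h => hτ (Prod.ext (funext fun i => by rw [Fin.fin_one_eq_zero i, h])
      (Subsingleton.elim _ _))
    simp [trajProb, this]
  · simp

theorem trajExp_const (P : Model S A) (s₁ : S) (π : Policy S A H) (x : ℝ) :
    trajExp P s₁ π (fun _ => x) = x := by
  induction H generalizing s₁ with
  | zero => rw [trajExp_zero]
  | succ H ih =>
    rw [trajExp_succ]
    simp only [ih, ← Finset.sum_mul, P.sum_eq_one, one_mul, π.sum_eq_one]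

theorem trajExp_mono (P : Model S A) (s₁ : S) (π : Policy S A H) {f g : Episode S A H → ℝ}
    (h : ∀ τ, f τ ≤ g τ) : trajExp P s₁ π f ≤ trajExp P s₁ π g :=
  Finset.sum_le_sum fun τ _ => mul_le_mul_of_nonneg_left (h τ) (trajProb_nonneg P s₁ π τ)

theorem trajExp_sum {ι : Type*} (t : Finset ι) (P : Model S A) (s₁ : S) (π : Policy S A H)
    (f : ι → Episode S A H → ℝ) :
    trajExp P s₁ π (fun τ => ∑ i ∈ t, f i τ) = ∑ i ∈ t, trajExp P s₁ π (f i) := by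
  unfold trajExp
  simp_rw [Finset.mul_sum]
  exact Finset.sum_comm

theorem trajExp_const_mul (P : Model S A) (s₁ : S) (π : Policy S A H) (x : ℝ)
    (f : Episode S A H → ℝ) : trajExp P s₁ π (fun τ => x * f τ) = x * trajExp P s₁ π f := by
  unfold trajExp
  rw [Finset.mul_sum]
  exact Finset.sum_congr rfl fun τ _ => by ring

theorem trajExp_add (P : Model S A) (s₁ : S) (π : Policy S A H)
    (f g : Episode S A H → ℝ) :
    trajExp P s₁ π (fun τ => f τ + g τ) = trajExp P s₁ π f + trajExp P s₁ π g := by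
  simp only [trajExp, mul_add, Finset.sum_add_distrib]

end Trajectories

/-! ### Occupancy measures: flow equation, linearity of values, convexity -/

section Occupancy

variable {S A : Type*} [Fintype S] [Fintype A] [DecidableEq S] {H : ℕ}

/-- The probability that the state at time step `h` is `s`. -/
def stateDist (P : Model S A) (s₁ : S) (π : Policy S A H) (h : Fin (H + 1)) (s : S) : ℝ :=
  trajExp P s₁ π (fun τ => if τ.1 h = s then 1 else 0)

theorem stateDist_zero (P : Model S A) (s₁ : S) (π : Policy S A H) (s : S) :
    stateDist P s₁ π 0 s = if s₁ = s then 1 else 0 := by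
  cases H with
  | zero => rw [stateDist, trajExp_zero]
  | succ H =>
    rw [stateDist, trajExp_succ]
    simp only [Fin.cons_zero, trajExp_const, ← Finset.sum_mul, P.sum_eq_one, one_mul,
      π.sum_eq_one]

/-- The Markov property: given the state and the action at a time step, the next state is drawn
from the model. -/
theorem trajExp_step [DecidableEq A] (P : Model S A) (s₁ : S) (π : Policy S A H) (h : Fin H)
    (s : S) (a : A) (g : S → ℝ) :
    trajExp P s₁ π (fun τ => if τ.1 h.castSucc = s ∧ τ.2 h = a then g (τ.1 h.succ) else 0) =
      stateDist P s₁ π h.castSucc s * π.prob h s a * ∑ s', P.prob s a s' * g s' := by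
  induction H generalizing s₁ with
  | zero => exact h.elim0
  | succ H ih =>
    rw [trajExp_succ]
    refine Fin.cases ?_ (fun h => ?_) h
    · have key : ∀ s' : S, ∀ b : A, trajExp P s' π.tail (fun τ =>
          if s₁ = s ∧ b = a then g (τ.1 0) else 0) = if s₁ = s ∧ b = a then g s' else 0 := by
        intro s' b
        split_ifs
        · have : ∀ τ : Episode S A H, g (τ.1 0) = ∑ x, g x * if τ.1 0 = x then 1 else 0 := by
            intro τ; simp
          simp_rw [this, trajExp_sum, trajExp_const_mul]
          have h0 := fun x => stateDist_zero P s' π.tail x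
          simp only [stateDist] at h0
          simp [h0]
        · exact trajExp_const _ _ _ _
      simp only [Fin.castSucc_zero, Fin.cons_zero, Fin.cons_succ, stateDist_zero, key]
      by_cases hs : s₁ = s
      · subst hs
        refine (Finset.sum_eq_single a (by intro b _ hb; simp [hb]) (by simp)).trans ?_
        simp
      · simp [hs]
    · simp only [← Fin.succ_castSucc, Fin.cons_succ, ih, stateDist]
      rw [trajExp_succ]
      generalize ∑ s', P.prob s a s' * g s' = Q
      simp only [Fin.cons_succ, Finset.sum_mul, Finset.mul_sum, Policy.tail]
      refine Finset.sum_congr rfl fun b _ => Finset.sum_congr rfl fun x _ => ?_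
      ring

theorem occupancy_eq_trajExp [DecidableEq A] (P : Model S A) (s₁ : S) (π : Policy S A H)
    (h : Fin H) (s : S) (a : A) :
    occupancy P s₁ π h s a =
      trajExp P s₁ π (fun τ => if τ.1 h.castSucc = s ∧ τ.2 h = a then 1 else 0) := by
  unfold occupancy trajExp
  refine Finset.sum_congr rfl fun τ _ => ?_
  simp [Set.indicator_apply]

theorem occupancy_eq_stateDist_mul (P : Model S A) (s₁ : S) (π : Policy S A H)
    (h : Fin H) (s : S) (a : A) :
    occupancy P s₁ π h s a = stateDist P s₁ π h.castSucc s * π.prob h s a := by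
  classical
  rw [occupancy_eq_trajExp]
  have := trajExp_step P s₁ π h s a (fun _ => 1)
  simpa [P.sum_eq_one] using this

/-- The flow equation. It is linear in the occupancy measure, which is why mixtures of occupancy
measures are again realizable. -/
theorem stateDist_succ (P : Model S A) (s₁ : S) (π : Policy S A H) (h : Fin H) (s' : S) :
    stateDist P s₁ π h.succ s' = ∑ s, ∑ a, occupancy P s₁ π h s a * P.prob s a s' := by
  classical
  have h1 : ∀ τ : Episode S A H, (if τ.1 h.succ = s' then (1 : ℝ) else 0) =
      ∑ s, ∑ a, if τ.1 h.castSucc = s ∧ τ.2 h = a then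
        (if τ.1 h.succ = s' then (1 : ℝ) else 0) else 0 := by
    intro τ
    simp [ite_and]
  simp only [stateDist]
  rw [funext h1, trajExp_sum]
  simp_rw [trajExp_sum]
  refine Finset.sum_congr rfl fun s _ => Finset.sum_congr rfl fun a _ => ?_
  rw [trajExp_step P s₁ π h s a (fun x => if x = s' then 1 else 0), occupancy_eq_stateDist_mul]
  simp

theorem value_eq_trajExp (P : Model S A) (s₁ : S) (π : Policy S A H) (l : S → A → ℝ) :
    value P s₁ π l = trajExp P s₁ π (fun τ => ∑ h : Fin H, l (τ.1 h.castSucc) (τ.2 h)) := rfl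

theorem value_eq_sum_occupancy (P : Model S A) (s₁ : S) (π : Policy S A H) (l : S → A → ℝ) :
    value P s₁ π l = ∑ h, ∑ s, ∑ a, occupancy P s₁ π h s a * l s a := by
  classical
  have h1 : ∀ (τ : Episode S A H) (h : Fin H), l (τ.1 h.castSucc) (τ.2 h) =
      ∑ s, ∑ a, l s a * if τ.1 h.castSucc = s ∧ τ.2 h = a then (1 : ℝ) else 0 := by
    intro τ h
    simp [ite_and]
  rw [value_eq_trajExp]
  simp_rw [h1, trajExp_sum, trajExp_const_mul, ← occupancy_eq_trajExp, mul_comm]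

theorem occupancy_nonneg (P : Model S A) (s₁ : S) (π : Policy S A H) (h : Fin H) (s : S) (a : A) :
    0 ≤ occupancy P s₁ π h s a :=
  Finset.sum_nonneg fun τ _ => Set.indicator_nonneg (fun τ _ => trajProb_nonneg P s₁ π τ) τ

theorem sum_occupancy_eq_stateDist (P : Model S A) (s₁ : S) (π : Policy S A H) (h : Fin H)
    (s : S) : ∑ a, occupancy P s₁ π h s a = stateDist P s₁ π h.castSucc s := by
  simp only [occupancy_eq_stateDist_mul, ← Finset.mul_sum, π.sum_eq_one, mul_one]

theorem sum_sum_occupancy (P : Model S A) (s₁ : S) (π : Policy S A H) (h : Fin H) :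
    ∑ s, ∑ a, occupancy P s₁ π h s a = 1 := by
  simp only [sum_occupancy_eq_stateDist, stateDist]
  rw [← trajExp_sum]
  simp [trajExp_const]

theorem stateDist_nonneg (P : Model S A) (s₁ : S) (π : Policy S A H) (h : Fin (H + 1)) (s : S) :
    0 ≤ stateDist P s₁ π h s := by
  have := trajExp_mono P s₁ π (f := fun _ => 0) (g := fun τ => if τ.1 h = s then 1 else 0)
    (fun τ => by split_ifs <;> norm_num)
  rwa [trajExp_const] at this

/-- The occupancy measures of a model form a convex set. -/
theorem exists_policy_occupancy_convex (P : Model S A) (s₁ : S) (π₀ π₁ : Policy S A H) {α : ℝ}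
    (hα₀ : 0 ≤ α) (hα₁ : α ≤ 1) :
    ∃ π : Policy S A H, ∀ s a h, occupancy P s₁ π h s a =
      (1 - α) * occupancy P s₁ π₀ h s a + α * occupancy P s₁ π₁ h s a := by
  classical
  set w : Fin H → S → A → ℝ := fun h s a =>
    (1 - α) * occupancy P s₁ π₀ h s a + α * occupancy P s₁ π₁ h s a with hw
  set d : Fin (H + 1) → S → ℝ := fun h s =>
    (1 - α) * stateDist P s₁ π₀ h s + α * stateDist P s₁ π₁ h s with hd
  have hα : 0 ≤ 1 - α := by linarith
  have hw0 : ∀ h s a, 0 ≤ w h s a := fun h s a => add_nonneg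
    (mul_nonneg hα (occupancy_nonneg ..)) (mul_nonneg hα₀ (occupancy_nonneg ..))
  have hd0 : ∀ h s, 0 ≤ d h s := fun h s => add_nonneg
    (mul_nonneg hα (stateDist_nonneg ..)) (mul_nonneg hα₀ (stateDist_nonneg ..))
  have hwd : ∀ h s, ∑ a, w h s a = d h.castSucc s := by
    intro h s
    simp only [hw, hd, Finset.sum_add_distrib, ← Finset.mul_sum, sum_occupancy_eq_stateDist]
  -- The conditional action distribution of the mixture. Where the mixture gives a state no mass,
  -- any distribution would do; `π₀` serves as default.
  let π : Policy S A H :=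
    { prob := fun h s a => if d h.castSucc s = 0 then π₀.prob h s a else w h s a / d h.castSucc s
      nonneg := fun h s a => by
        split_ifs
        · exact π₀.nonneg _ _ _
        · exact div_nonneg (hw0 _ _ _) (hd0 _ _)
      sum_eq_one := fun h s => by
        by_cases h0 : d h.castSucc s = 0
        · simp [h0, π₀.sum_eq_one]
        · simp [h0, ← Finset.sum_div, hwd] }
  have hπ : ∀ h s a, d h.castSucc s * π.prob h s a = w h s a := by
    intro h s a
    by_cases h0 : d h.castSucc s = 0
    · have := (Finset.sum_eq_zero_iff_of_nonneg (fun a _ => hw0 h s a)).1 ((hwd h s).trans h0) a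
        (Finset.mem_univ a)
      rw [this, h0, zero_mul]
    · simp only [π, h0, if_false]
      field_simp
  -- Both sides have the same initial value and obey the same flow equation.
  have hstate : ∀ h s, stateDist P s₁ π h s = d h s := by
    intro h
    induction h using Fin.induction with
    | zero =>
      intro s
      simp only [hd, stateDist_zero]
      ring
    | succ h ih =>
      intro s
      simp only [hd, stateDist_succ, Finset.mul_sum, ← Finset.sum_add_distrib]
      refine Finset.sum_congr rfl fun x _ => Finset.sum_congr rfl fun a _ => ?_
      rw [occupancy_eq_stateDist_mul P s₁ π, ih, hπ]
      simp only [hw]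
      ring
  refine ⟨π, fun s a h => ?_⟩
  rw [occupancy_eq_stateDist_mul, hstate, hπ]

end Occupancy

/-! ### The law of a run and supermartingales along episodes -/

section Runs

variable {S A : Type*} [Fintype S] [Fintype A] [DecidableEq S] {H : ℕ}

theorem runWeight_nonneg (M : CMDP S A H) (alg : Algorithm S A H) {K : ℕ}
    (ω : Fin K → Episode S A H) : 0 ≤ runWeight M alg ω :=
  Finset.prod_nonneg fun _ _ => trajProb_nonneg _ _ _ _

theorem runWeight_snoc (M : CMDP S A H) (alg : Algorithm S A H) {K : ℕ}
    (ω : Fin K → Episode S A H) (τ : Episode S A H) :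
    runWeight M alg (Fin.snoc ω τ : Fin (K + 1) → Episode S A H) =
      runWeight M alg ω * trajProb M.P M.s₁ (alg K ω) τ := by
  unfold runWeight
  rw [Fin.prod_univ_castSucc]
  congr 1
  · refine Finset.prod_congr rfl fun k _ => ?_
    have : past (Fin.snoc ω τ : Fin (K + 1) → Episode S A H) k.castSucc = past ω k := by
      funext j
      exact Fin.snoc_castSucc (α := fun _ => Episode S A H) τ ω (j.castLE k.isLt.le)
    rw [Fin.snoc_castSucc]
    exact congrArg (fun x => trajProb M.P M.s₁ (alg k x) (ω k)) this
  · have : past (Fin.snoc ω τ : Fin (K + 1) → Episode S A H) (Fin.last K) = ω := by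
      funext j
      exact Fin.snoc_castSucc (α := fun _ => Episode S A H) τ ω j
    rw [Fin.snoc_last]
    exact congrArg (fun x => trajProb M.P M.s₁ (alg K x) τ) this

/-- A function of the history that is a supermartingale along the episodes has an expectation of
at most its initial value. -/
theorem sum_runWeight_mul_le (M : CMDP S A H) (alg : Algorithm S A H)
    (G : (m : ℕ) → (Fin m → Episode S A H) → ℝ)
    (hG : ∀ m hist, trajExp M.P M.s₁ (alg m hist)
      (fun τ => G (m + 1) (Fin.snoc hist τ : Fin (m + 1) → Episode S A H)) ≤ G m hist) (K : ℕ) :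
    ∑ ω : Fin K → Episode S A H, runWeight M alg ω * G K ω ≤ G 0 Fin.elim0 := by
  induction K with
  | zero =>
    rw [Fintype.sum_subsingleton _ (Fin.elim0 : Fin 0 → Episode S A H)]
    simp [runWeight]
  | succ K ih =>
    refine le_trans ?_ ih
    rw [← (Fin.snocEquiv (fun _ => Episode S A H)).sum_comp, Fintype.sum_prod_type,
      Finset.sum_comm]
    refine Finset.sum_le_sum fun ω _ => ?_
    have h1 : ∀ τ, (Fin.snocEquiv (fun _ : Fin (K + 1) => Episode S A H)) (τ, ω) =
      (Fin.snoc ω τ : Fin (K + 1) → Episode S A H) := fun τ => rfl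
    simp only [h1, runWeight_snoc, mul_assoc, ← Finset.mul_sum]
    exact mul_le_mul_of_nonneg_left (hG K ω) (runWeight_nonneg _ _ _)

theorem sum_runWeight (M : CMDP S A H) (alg : Algorithm S A H) (K : ℕ) :
    ∑ ω : Fin K → Episode S A H, runWeight M alg ω = 1 := by
  -- The constants `1` and `-1` are both supermartingales, which gives the two inequalities.
  have h1 := sum_runWeight_mul_le M alg (fun _ _ => 1) (fun m hist => by rw [trajExp_const]) K
  have h2 := sum_runWeight_mul_le M alg (fun _ _ => -1) (fun m hist => by rw [trajExp_const]) K
  simp only [mul_one, mul_neg, Finset.sum_neg_distrib] at h1 h2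
  linarith

end Runs

/-! ### The run as one list of transitions, and products stopped at the `n`-th visit -/

section TransitionLists

variable {S A : Type*} {H : ℕ}

/-- The transitions of an episode, the latest first, in front of the transitions `l` before it. -/
def episodeList (τ : Episode S A H) (l : List (S × A × S)) : List (S × A × S) :=
  (List.ofFn fun h : Fin H => (τ.1 h.castSucc, τ.2 h, τ.1 h.succ)).reverse ++ l

theorem episodeList_cons (s : S) (a : A) (τ : Episode S A H) (l : List (S × A × S)) :
    episodeList ((Fin.cons s τ.1 : Fin (H + 2) → S), (Fin.cons a τ.2 : Fin (H + 1) → A)) l =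
      episodeList τ ((s, a, τ.1 0) :: l) := by
  simp [episodeList, List.ofFn_succ]

/-- The transitions of all episodes of a history, the latest first. -/
def historyList : (m : ℕ) → (Fin m → Episode S A H) → List (S × A × S)
  | 0, _ => []
  | m + 1, hist => episodeList (hist (Fin.last m)) (historyList m fun j => hist j.castSucc)

theorem historyList_snoc {m : ℕ} (hist : Fin m → Episode S A H) (τ : Episode S A H) :
    historyList (m + 1) (Fin.snoc hist τ : Fin (m + 1) → Episode S A H) =
      episodeList τ (historyList m hist) := by
  simp [historyList]

/-- Because the latest transitions come first, the past is a suffix. This allows a quantity frozen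
in the past to be read off at the end of the run. -/
theorem historyList_suffix {K : ℕ} (ω : Fin K → Episode S A H) {m : ℕ} (hm : m ≤ K) :
    historyList m (fun j => ω (j.castLE hm)) <:+ historyList K ω := by
  induction K with
  | zero =>
    obtain rfl : m = 0 := by omega
    exact List.suffix_rfl
  | succ K ih =>
    rcases Nat.lt_or_ge K m with h | h
    · obtain rfl : m = K + 1 := by omega
      exact List.suffix_rfl
    · exact (ih (fun j => ω j.castSucc) h).trans (List.suffix_append _ _)

theorem countP_ofFn {X : Type*} (p : X → Bool) {n : ℕ} (g : Fin n → X) :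
    (List.ofFn g).countP p = ∑ i, if p (g i) then 1 else 0 := by
  induction n with
  | zero => simp
  | succ n ih => rw [List.ofFn_succ, List.countP_cons, ih, Fin.sum_univ_succ, add_comm]

theorem countP_historyList (p : S × A × S → Bool) {m : ℕ} (hist : Fin m → Episode S A H) :
    (historyList m hist).countP p = ∑ j : Fin m, ∑ h : Fin H,
      if p ((hist j).1 h.castSucc, (hist j).2 h, (hist j).1 h.succ) then 1 else 0 := by
  induction m with
  | zero => simp [historyList]
  | succ m ih =>
    rw [historyList, episodeList, List.countP_append, List.countP_reverse, countP_ofFn, ih,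
      Fin.sum_univ_castSucc, add_comm]

/-- The supermartingale property for single transitions, whatever the action, passes to whole
episodes by induction on the horizon; the policy only averages over actions. -/
theorem trajExp_episodeList_le [Fintype S] [Fintype A] [DecidableEq S] (P : Model S A) (s₁ : S) (π : Policy S A H)
    (Z : List (S × A × S) → ℝ)
    (hZ : ∀ s a l, ∑ s', P.prob s a s' * Z ((s, a, s') :: l) ≤ Z l) (l : List (S × A × S)) :
    trajExp P s₁ π (fun τ => Z (episodeList τ l)) ≤ Z l := by
  induction H generalizing s₁ l with
  | zero => rw [trajExp_zero]; simp [episodeList]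
  | succ H ih =>
    rw [trajExp_succ]
    simp only [episodeList_cons]
    have key : ∀ s' a, trajExp P s' π.tail (fun τ => Z (episodeList τ ((s₁, a, τ.1 0) :: l))) ≤
        Z ((s₁, a, s') :: l) := by
      intro s' a
      refine le_of_eq_of_le ?_ (ih s' π.tail ((s₁, a, s') :: l))
      refine Finset.sum_congr rfl fun τ _ => ?_
      -- Trajectories that do not start in `s'` have weight zero, so `τ.1 0` may be replaced by
      -- `s'`.
      by_cases h : τ.1 0 = s'
      · simp only [h]
      · simp [trajProb, h]
    calc _ ≤ ∑ a, π.prob 0 s₁ a * Z l := by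
          refine Finset.sum_le_sum fun a _ => mul_le_mul_of_nonneg_left ?_ (π.nonneg _ _ _)
          refine le_trans (Finset.sum_le_sum fun s' _ => ?_) (hZ s₁ a l)
          exact mul_le_mul_of_nonneg_left (key s' a) (P.nonneg _ _ _)
      _ = Z l := by rw [← Finset.sum_mul, π.sum_eq_one, one_mul]

variable [DecidableEq S] [DecidableEq A]

/-- The number of transitions in `l` that start with the state `s` and the action `a`. -/
def listVisits (s : S) (a : A) (l : List (S × A × S)) : ℕ :=
  l.countP fun x => x.1 = s ∧ x.2.1 = a

/-- The number of transitions in `l` from `s` to `s'` with the action `a`. -/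
def listTransitions (s : S) (a : A) (s' : S) (l : List (S × A × S)) : ℕ :=
  l.countP fun x => x.1 = s ∧ x.2.1 = a ∧ x.2.2 = s'

theorem listVisits_historyList (s : S) (a : A) {m : ℕ} (hist : Fin m → Episode S A H) :
    listVisits s a (historyList m hist) = visits hist s a := by
  simp [listVisits, countP_historyList, visits]

theorem listTransitions_historyList (s : S) (a : A) (s' : S) {m : ℕ}
    (hist : Fin m → Episode S A H) :
    listTransitions s a s' (historyList m hist) = transitions hist s a s' := by
  simp [listTransitions, countP_historyList, transitions]

theorem listTransitions_le_listVisits (s : S) (a : A) (s' : S) (l : List (S × A × S)) :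
    listTransitions s a s' l ≤ listVisits s a l :=
  List.countP_mono_left fun x _ => by simp +contextual

/-- The product of `f` over the next states of the first `n` visits to `(s, a)`. -/
def stoppedProd (s : S) (a : A) (n : ℕ) (f : S → ℝ) : List (S × A × S) → ℝ
  | [] => 1
  | x :: l => if x.1 = s ∧ x.2.1 = a ∧ listVisits s a l < n then f x.2.2 * stoppedProd s a n f l
      else stoppedProd s a n f l

theorem stoppedProd_nonneg (s : S) (a : A) (n : ℕ) {f : S → ℝ} (hf : ∀ x, 0 ≤ f x)
    (l : List (S × A × S)) : 0 ≤ stoppedProd s a n f l := by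
  induction l with
  | nil => simp [stoppedProd]
  | cons x l ih =>
    rw [stoppedProd]
    split_ifs
    · exact mul_nonneg (hf _) ih
    · exact ih

/-- After `n` visits no factor is added any more, so the product keeps its value to the end of the
run. -/
theorem stoppedProd_of_suffix (s : S) (a : A) (n : ℕ) (f : S → ℝ) {l l' : List (S × A × S)}
    (h : l <:+ l') (hn : n ≤ listVisits s a l) :
    stoppedProd s a n f l' = stoppedProd s a n f l := by
  obtain ⟨t, rfl⟩ := h
  induction t with
  | nil => rfl
  | cons x t ih =>
    have : ¬ listVisits s a (t ++ l) < n := by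
      have : listVisits s a l ≤ listVisits s a (t ++ l) := by
        simp [listVisits, List.countP_append]
      omega
    simp [stoppedProd, this, ih]

theorem stoppedProd_eq_exp (s : S) (a : A) (s' : S) (n : ℕ) (x y : ℝ) {l : List (S × A × S)}
    (hl : listVisits s a l ≤ n) :
    stoppedProd s a n (fun z => Real.exp (x * (if z = s' then 1 else 0) - y)) l =
      Real.exp (x * listTransitions s a s' l - y * listVisits s a l) := by
  induction l with
  | nil => simp [stoppedProd, listVisits, listTransitions]
  | cons z l ih =>
    obtain ⟨z₁, z₂, z₃⟩ := z
    simp only [stoppedProd]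
    by_cases h : z₁ = s ∧ z₂ = a
    · obtain ⟨rfl, rfl⟩ := h
      have hv : listVisits z₁ z₂ ((z₁, z₂, z₃) :: l) = listVisits z₁ z₂ l + 1 := by
        simp [listVisits]
      have ht : listTransitions z₁ z₂ s' ((z₁, z₂, z₃) :: l) =
          listTransitions z₁ z₂ s' l + if z₃ = s' then 1 else 0 := by
        simp [listTransitions, List.countP_cons]
      rw [hv] at hl
      rw [if_pos ⟨rfl, rfl, by omega⟩, ih (by omega), hv, ht, ← Real.exp_add]
      congr 1
      push_cast
      ring
    · have hv : listVisits s a ((z₁, z₂, z₃) :: l) = listVisits s a l := by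
        simp [listVisits, List.countP_cons]
        tauto
      have ht : listTransitions s a s' ((z₁, z₂, z₃) :: l) = listTransitions s a s' l := by
        simp [listTransitions, List.countP_cons]
        tauto
      rw [if_neg (by tauto), hv, ht, ih (by omega)]

variable [Fintype S]

/-- One transition either adds a factor of mean at most 1 or leaves the product alone. -/
theorem sum_mul_stoppedProd_le (P : Model S A) (s : S) (a : A) (n : ℕ) {f : S → ℝ}
    (hf : ∀ x, 0 ≤ f x) (hP : ∑ z, P.prob s a z * f z ≤ 1) (x : S) (b : A)
    (l : List (S × A × S)) :
    ∑ z, P.prob x b z * stoppedProd s a n f ((x, b, z) :: l) ≤ stoppedProd s a n f l := by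
  simp only [stoppedProd]
  split_ifs with h
  · obtain ⟨rfl, rfl, -⟩ := h
    simp only [← mul_assoc, ← Finset.sum_mul]
    exact mul_le_of_le_one_left (stoppedProd_nonneg _ _ _ hf _) hP
  · rw [← Finset.sum_mul, P.sum_eq_one, one_mul]

variable [Fintype A]

/-- The product of `f` over the first `n` visits to `(s, a)` has expectation at most `1` if `f`
has expectation at most `1` under the transition distribution. -/
theorem sum_runWeight_mul_stoppedProd_le (M : CMDP S A H) (alg : Algorithm S A H) (K : ℕ)
    (s : S) (a : A) (n : ℕ) {f : S → ℝ} (hf : ∀ x, 0 ≤ f x)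
    (hP : ∑ z, M.P.prob s a z * f z ≤ 1) :
    ∑ ω : Fin K → Episode S A H, runWeight M alg ω * stoppedProd s a n f (historyList K ω) ≤ 1 := by
  have := sum_runWeight_mul_le M alg (fun m hist => stoppedProd s a n f (historyList m hist))
    (fun m hist => by
      simp only [historyList_snoc]
      exact trajExp_episodeList_le M.P M.s₁ _ _ (sum_mul_stoppedProd_le M.P s a n hf hP) _) K
  simpa [historyList, stoppedProd] using this

end TransitionLists

/-! ### Bernstein's inequality: moment generating function, tilt, empirical variance -/

section Bernstein

/-- After clearing the denominator `6 - 2 x` the claim is `0 ≤ g x`. The second derivative of `g` is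
nonnegative by `1 - y ≤ exp (-y)`, and `g` and `g'` vanish at 0, so 0 is the minimum of `g`. -/
theorem exp_le_one_add_add_sq_div {x : ℝ} (hx : x < 3) :
    Real.exp x ≤ 1 + x + x ^ 2 / (2 * (1 - x / 3)) := by
  set g' : ℝ → ℝ := fun y => 4 + 2 * y - (4 - 2 * y) * Real.exp y with hg'
  set g : ℝ → ℝ := fun y => 6 + 4 * y + y ^ 2 - (6 - 2 * y) * Real.exp y with hg
  have h1 : ∀ y, HasDerivAt g (g' y) y := by
    intro y
    have := ((((hasDerivAt_id y).const_mul 4).const_add 6).add ((hasDerivAt_id y).pow 2)).sub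
      ((((hasDerivAt_id y).const_mul 2).const_sub 6).mul (Real.hasDerivAt_exp y))
    refine (this.congr_deriv ?_)
    simp [hg']
    ring
  have h2 : ∀ y, HasDerivAt g' (2 - (2 - 2 * y) * Real.exp y) y := by
    intro y
    have := (((hasDerivAt_id y).const_mul 2).const_add 4).sub
      ((((hasDerivAt_id y).const_mul 2).const_sub 4).mul (Real.hasDerivAt_exp y))
    refine (this.congr_deriv ?_)
    simp
    ring
  have h3 : ∀ y, 0 ≤ 2 - (2 - 2 * y) * Real.exp y := by
    intro y
    have h : 1 - y ≤ Real.exp (-y) := by linarith [Real.add_one_le_exp (-y)]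
    have h' : (1 - y) * Real.exp y ≤ 1 := by
      calc (1 - y) * Real.exp y ≤ Real.exp (-y) * Real.exp y :=
            mul_le_mul_of_nonneg_right h (Real.exp_pos y).le
        _ = 1 := by rw [← Real.exp_add]; simp
    linarith
  have hmono : Monotone g' := monotone_of_hasDerivAt_nonneg h2 h3
  have h0 : g' 0 = 0 := by simp [hg']
  have hpos : 0 ≤ g x := by
    have hg0 : g 0 = 0 := by simp [hg]
    rcases le_total 0 x with hx0 | hx0
    · have : MonotoneOn g (Set.Ici 0) := monotoneOn_of_deriv_nonneg (convex_Ici 0)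
        (fun y _ => (h1 y).continuousAt.continuousWithinAt)
        (fun y _ => (h1 y).differentiableAt.differentiableWithinAt)
        (fun y hy => by
          rw [(h1 y).deriv, ← h0]
          rw [interior_Ici] at hy
          exact hmono (le_of_lt hy))
      rw [← hg0]
      exact this (Set.mem_Ici.2 le_rfl) hx0 hx0
    · have : AntitoneOn g (Set.Iic 0) := antitoneOn_of_deriv_nonpos (convex_Iic 0)
        (fun y _ => (h1 y).continuousAt.continuousWithinAt)
        (fun y _ => (h1 y).differentiableAt.differentiableWithinAt)
        (fun y hy => by
          rw [(h1 y).deriv, ← h0]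
          rw [interior_Iic] at hy
          exact hmono (le_of_lt hy))
      rw [← hg0]
      exact this hx0 (Set.mem_Iic.2 le_rfl) hx0
  have h3x : 0 < 3 - x := by linarith
  have : 1 + x + x ^ 2 / (2 * (1 - x / 3)) = (6 + 4 * x + x ^ 2) / (6 - 2 * x) := by
    have h6 : 6 - 2 * x ≠ 0 := by linarith
    rw [show 2 * (1 - x / 3) = (6 - 2 * x) / 3 by ring, div_div_eq_mul_div, eq_div_iff h6, add_mul,
      div_mul_cancel₀ _ h6]
    ring
  rw [this, le_div_iff₀ (by linarith)]
  simp only [hg] at hpos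
  linarith

theorem exp_mul_le_of_le_one {t y : ℝ} (ht₀ : 0 ≤ t) (ht : t < 3) (hy : y ≤ 1) :
    Real.exp (t * y) ≤ 1 + t * y + y ^ 2 * (t ^ 2 / (2 * (1 - t / 3))) := by
  have hty : t * y ≤ t := mul_le_of_le_one_right ht₀ hy
  refine (exp_le_one_add_add_sq_div (by linarith)).trans ?_
  have : (t * y) ^ 2 / (2 * (1 - t * y / 3)) ≤ (t * y) ^ 2 / (2 * (1 - t / 3)) := by
    apply div_le_div_of_nonneg_left (sq_nonneg _) <;> linarith
  calc _ ≤ 1 + t * y + (t * y) ^ 2 / (2 * (1 - t / 3)) := by linarith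
    _ = _ := by ring

variable {S A : Type*} [Fintype S]

theorem Model.prob_le_one (P : Model S A) (s : S) (a : A) (s' : S) : P.prob s a s' ≤ 1 := by
  rw [← P.sum_eq_one s a]
  exact Finset.single_le_sum (fun z _ => P.nonneg s a z) (Finset.mem_univ s')

variable [DecidableEq S]

/-- Bernstein's bound on the moment generating function of the indicator of a transition. The
number `e` is a sign. -/
theorem sum_prob_mul_exp_le_one (P : Model S A) (s : S) (a : A) (s' : S) {t e v : ℝ}
    (ht₀ : 0 ≤ t) (ht : t < 3) (he : e = 1 ∨ e = -1)
    (hv : P.prob s a s' * (1 - P.prob s a s') ≤ v) :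
    ∑ z, P.prob s a z * Real.exp (t * e * (if z = s' then 1 else 0) -
      (t * e * P.prob s a s' + v * (t ^ 2 / (2 * (1 - t / 3))))) ≤ 1 := by
  set p := P.prob s a s' with hp
  set B := t ^ 2 / (2 * (1 - t / 3)) with hB
  have hB0 : 0 ≤ B := by
    have : 0 < 1 - t / 3 := by linarith
    positivity
  have hp0 : 0 ≤ p := P.nonneg _ _ _
  have hp1 : p ≤ 1 := P.prob_le_one _ _ _
  have hI : ∑ z, P.prob s a z * (if z = s' then (1 : ℝ) else 0) = p := by simp [hp]
  have h1 : ∀ z, Real.exp (t * e * (if z = s' then 1 else 0) - (t * e * p + v * B)) =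
      Real.exp (t * (e * ((if z = s' then 1 else 0) - p))) * Real.exp (-(v * B)) := by
    intro z
    rw [← Real.exp_add]
    congr 1
    ring
  have he2 : e ^ 2 = 1 := by rcases he with h | h <;> simp [h]
  -- The square of the indicator is the indicator, so the quadratic bound is affine in it and can be
  -- summed with `hI`; the sum is `1 + p (1 - p) B`.
  have h2 : ∀ z, P.prob s a z * Real.exp (t * (e * ((if z = s' then 1 else 0) - p))) ≤
      P.prob s a z * (1 - t * e * p + p ^ 2 * B) +
        (P.prob s a z * (if z = s' then 1 else 0)) * (t * e + (1 - 2 * p) * B) := by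
    intro z
    have := exp_mul_le_of_le_one (y := e * ((if z = s' then 1 else 0) - p)) ht₀ ht (by
      rcases he with rfl | rfl <;> split_ifs <;> linarith)
    refine (mul_le_mul_of_nonneg_left this (P.nonneg s a z)).trans (le_of_eq ?_)
    rw [mul_pow, he2]
    split_ifs <;> ring
  simp only [h1, ← mul_assoc, ← Finset.sum_mul]
  have h3 : ∑ z, P.prob s a z * Real.exp (t * (e * ((if z = s' then 1 else 0) - p))) ≤
      Real.exp (v * B) := by
    refine (Finset.sum_le_sum fun z _ => h2 z).trans ?_
    rw [Finset.sum_add_distrib, ← Finset.sum_mul, ← Finset.sum_mul, hI, P.sum_eq_one]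
    calc _ = p * (1 - p) * B + 1 := by ring
      _ ≤ v * B + 1 := by gcongr
      _ ≤ _ := Real.add_one_le_exp _
  calc _ ≤ Real.exp (v * B) * Real.exp (-(v * B)) := by
        refine mul_le_mul_of_nonneg_right ?_ (Real.exp_pos _).le
        simpa only [mul_assoc] using h3
    _ = 1 := by rw [← Real.exp_add]; simp

/-- The Chernoff exponent of Bernstein's inequality is attained at this tilt. -/
theorem bernstein_tilt {lam v : ℝ} (hl : 0 < lam) (hv : 0 < v) :
    ∃ t, 0 ≤ t ∧ t < 3 ∧
      t * (Real.sqrt (3 * lam * v) + lam / 2) - v * (t ^ 2 / (2 * (1 - t / 3))) =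
        3 / 2 * lam := by
  set q := Real.sqrt (3 * lam / v) with hq
  have hq0 : 0 < q := Real.sqrt_pos.2 (by positivity)
  have hq2 : q ^ 2 * v = 3 * lam := by
    rw [hq, Real.sq_sqrt (by positivity)]
    field_simp
  have hs : Real.sqrt (3 * lam * v) = q * v := by
    rw [show 3 * lam * v = (q * v) ^ 2 by rw [← hq2]; ring]
    exact Real.sqrt_sq (by positivity)
  -- With this `t` one has `1 - t / 3 = 1 / (1 + q / 3)`, and the exponent simplifies to `q² v / 2`,
  -- which is `3 / 2 * lam` by the choice of `q`.
  refine ⟨q / (1 + q / 3), by positivity, ?_, ?_⟩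
  · rw [div_lt_iff₀ (by positivity)]
    linarith
  · have h1 : 1 - q / (1 + q / 3) / 3 = 1 / (1 + q / 3) := by
      field_simp
      ring
    rw [hs, h1, show lam = q ^ 2 * v / 3 by linarith]
    field_simp
    ring

/-- Bernstein's bound with the true variance implies the bound with the empirical variance. -/
theorem abs_sub_le_of_bernstein {p q lam : ℝ} (hp₀ : 0 ≤ p) (hp₁ : p ≤ 1) (hq₀ : 0 ≤ q)
    (hq₁ : q ≤ 1) (hl : 0 ≤ lam)
    (h : |p - q| ≤ Real.sqrt (3 * lam * (p * (1 - p) + lam)) + lam / 2) :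
    |p - q| ≤ Real.sqrt (4 * (q * (1 - q)) * lam) + 14 / 3 * lam := by
  set x := |p - q| with hx
  set y := Real.sqrt (4 * (q * (1 - q)) * lam) with hy
  have hq : 0 ≤ q * (1 - q) := mul_nonneg hq₀ (by linarith)
  have hp : 0 ≤ p * (1 - p) := mul_nonneg hp₀ (by linarith)
  have hy0 : 0 ≤ y := Real.sqrt_nonneg _
  have hy2 : y ^ 2 = 4 * (q * (1 - q)) * lam := Real.sq_sqrt (by positivity)
  by_contra! hlt
  -- The function `p (1 - p)` is 1-Lipschitz on the unit interval, so the true variance exceeds the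
  -- empirical one by at most the deviation itself. What remains is a quadratic inequality in `x`.
  have hvar : p * (1 - p) ≤ q * (1 - q) + x := by
    have h1 : p * (1 - p) - q * (1 - q) = (p - q) * (1 - p - q) := by ring
    have h2 : (p - q) * (1 - p - q) ≤ |p - q| * 1 := by
      refine (le_abs_self _).trans ?_
      rw [abs_mul]
      refine mul_le_mul_of_nonneg_left ?_ (abs_nonneg _)
      rw [abs_le]
      constructor <;> linarith
    linarith
  have h1 : x - lam / 2 ≤ Real.sqrt (3 * lam * (p * (1 - p) + lam)) := by linarith
  have h2 : 0 ≤ x - lam / 2 := by linarith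
  have h3 : (x - lam / 2) ^ 2 ≤ 3 * lam * (p * (1 - p) + lam) := by
    have := pow_le_pow_left₀ h2 h1 2
    rwa [Real.sq_sqrt (by positivity)] at this
  have h4 : (x - lam / 2) ^ 2 ≤ 3 * lam * (q * (1 - q) + x + lam) :=
    h3.trans (by gcongr)
  -- With `d > 0`, the square of `d + y + 25/6 lam` would be at most `3/4 y² + 3 lam (d + y) + 17
  -- lam²`. This is impossible since `(25/6)² > 17`; here the constant `14/3` enters.
  set d := x - (y + 14 / 3 * lam) with hd
  have hd0 : 0 < d := by linarith
  have hxe : x = d + y + 14 / 3 * lam := by rw [hd]; ring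
  rw [hxe] at h4
  nlinarith [mul_nonneg hy0 hl, mul_nonneg hd0.le hl, mul_nonneg hd0.le hy0, sq_nonneg lam,
    mul_pos hd0 hd0, sq_nonneg y]

end Bernstein

/-! ### Visit counts -/

section Visits

variable {S A : Type*} [DecidableEq S] [DecidableEq A] {H : ℕ}

theorem transitions_le_visits {m : ℕ} (hist : Fin m → Episode S A H) (s : S) (a : A) (s' : S) :
    transitions hist s a s' ≤ visits hist s a := by
  rw [← listVisits_historyList, ← listTransitions_historyList]
  exact listTransitions_le_listVisits _ _ _ _

theorem visits_le {m : ℕ} (hist : Fin m → Episode S A H) (s : S) (a : A) :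
    visits hist s a ≤ H * m := by
  calc visits hist s a ≤ ∑ _j : Fin m, ∑ _h : Fin H, 1 :=
        Finset.sum_le_sum fun _ _ => Finset.sum_le_sum fun _ _ => by split_ifs <;> simp
    _ = H * m := by simp [mul_comm]

/-- The number of visits to `(s, a)` in one episode. -/
def episodeVisits (s : S) (a : A) (τ : Episode S A H) : ℝ :=
  ∑ h : Fin H, if τ.1 h.castSucc = s ∧ τ.2 h = a then 1 else 0

theorem episodeVisits_nonneg (s : S) (a : A) (τ : Episode S A H) : 0 ≤ episodeVisits s a τ :=
  Finset.sum_nonneg fun _ _ => by split_ifs <;> norm_num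

theorem episodeVisits_le (s : S) (a : A) (τ : Episode S A H) : episodeVisits s a τ ≤ H := by
  calc episodeVisits s a τ ≤ ∑ _h : Fin H, (1 : ℝ) :=
        Finset.sum_le_sum fun _ _ => by split_ifs <;> norm_num
    _ = H := by simp

theorem sum_episodeVisits_le_visits {K : ℕ} (ω : Fin K → Episode S A H) (k : Fin K) {m : ℕ}
    (hm : m ≤ k) (s : S) (a : A) :
    ∑ j : Fin m, episodeVisits s a (ω (j.castLE (hm.trans k.isLt.le))) ≤
      visits (past ω k) s a := by
  have : (visits (past ω k) s a : ℝ) = ∑ j : Fin (k : ℕ), episodeVisits s a (past ω k j) := by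
    simp [visits, episodeVisits]
  rw [this]
  have hinj : Function.Injective (Fin.castLE hm) := Fin.castLE_injective hm
  refine le_of_eq_of_le
    (Finset.sum_map Finset.univ ⟨_, hinj⟩ fun j => episodeVisits s a (past ω k j)).symm ?_
  exact Finset.sum_le_sum_of_subset_of_nonneg (Finset.subset_univ _)
    fun j _ _ => episodeVisits_nonneg _ _ _

end Visits

/-! ### The true model lies in the confidence sets -/

section Concentration

variable {S A : Type*} [Fintype S] [Fintype A] [DecidableEq S] {H : ℕ}

/-- Markov's inequality for the law of a run. -/
theorem one_sub_le_runProb (M : CMDP S A H) (alg : Algorithm S A H) {K : ℕ}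
    {E : Set (Fin K → Episode S A H)} {Z : (Fin K → Episode S A H) → ℝ} {b : ℝ}
    (hZ : ∀ ω, 0 ≤ Z ω) (hE : ∀ ω, ω ∉ E → 1 ≤ Z ω)
    (hb : ∑ ω, runWeight M alg ω * Z ω ≤ b) : 1 - b ≤ runProb M alg E := by
  have h : ∑ ω : Fin K → Episode S A H, (runWeight M alg ω - runWeight M alg ω * Z ω) ≤
      runProb M alg E := by
    refine Finset.sum_le_sum fun ω _ => ?_
    have hw := runWeight_nonneg M alg ω
    by_cases hω : ω ∈ E
    · rw [Set.indicator_of_mem hω]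
      nlinarith [mul_nonneg hw (hZ ω)]
    · rw [Set.indicator_of_notMem hω]
      nlinarith [mul_le_mul_of_nonneg_left (hE ω hω) hw]
  rw [Finset.sum_sub_distrib, sum_runWeight] at h
  linarith

variable [DecidableEq A]

/-- Bernstein's inequality with the empirical variance, for the moment of the `n`-th visit to
`(s, a)`. -/
theorem exists_bernstein_weight (M : CMDP S A H) (s : S) (a : A) (s' : S) {n : ℕ} (hn : 0 < n)
    {L : ℝ} (hL : 0 < L) :
    ∃ Z : List (S × A × S) → ℝ, (∀ l, 0 ≤ Z l) ∧
      (∀ (alg : Algorithm S A H) (K : ℕ),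
        ∑ ω : Fin K → Episode S A H, runWeight M alg ω * Z (historyList K ω) ≤ 2) ∧
      ∀ l l' : List (S × A × S), l <:+ l' → listVisits s a l = n →
        Real.sqrt (4 * ((listTransitions s a s' l / n : ℝ) *
          (1 - listTransitions s a s' l / n)) * (L / n)) + 14 / 3 * (L / n) <
            |M.P.prob s a s' - listTransitions s a s' l / n| →
        Real.exp (3 / 2 * L) ≤ Z l' := by
  have hn' : (0 : ℝ) < n := by exact_mod_cast hn
  set p := M.P.prob s a s' with hp
  have hp0 : 0 ≤ p := M.P.nonneg _ _ _
  have hp1 : p ≤ 1 := M.P.prob_le_one _ _ _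
  set lam := L / n with hlam
  have hlam0 : 0 < lam := div_pos hL hn'
  -- The added `lam` keeps the variance proxy positive when `p` is 0 or 1. Since `n` is fixed, `v`
  -- and the tilt `t` are deterministic.
  set v := p * (1 - p) + lam with hv
  have hv0 : 0 < v := add_pos_of_nonneg_of_pos (mul_nonneg hp0 (by linarith)) hlam0
  obtain ⟨t, ht0, ht3, ht⟩ := bernstein_tilt hlam0 hv0
  set B := t ^ 2 / (2 * (1 - t / 3)) with hB
  let f : ℝ → S → ℝ := fun e z => Real.exp (t * e * (if z = s' then 1 else 0) - (t * e * p + v * B))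
  have hf : ∀ e z, 0 ≤ f e z := fun e z => (Real.exp_pos _).le
  have hZ0 : ∀ e l, 0 ≤ stoppedProd s a n (f e) l := fun e l => stoppedProd_nonneg s a n (hf e) l
  have hsum : ∀ e, e = 1 ∨ e = -1 → ∀ (alg : Algorithm S A H) (K : ℕ),
      ∑ ω : Fin K → Episode S A H, runWeight M alg ω *
        stoppedProd s a n (f e) (historyList K ω) ≤ 1 := fun e he alg K =>
    sum_runWeight_mul_stoppedProd_le M alg K s a n (hf e)
      (sum_prob_mul_exp_le_one M.P s a s' ht0 ht3 he (by rw [hv]; linarith))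
  -- One product for each sign of the deviation, hence the bound 2.
  refine ⟨fun l => stoppedProd s a n (f 1) l + stoppedProd s a n (f (-1)) l,
    fun l => add_nonneg (hZ0 _ _) (hZ0 _ _), fun alg K => ?_, fun l l' hl hvis hdev => ?_⟩
  · simp only [mul_add, Finset.sum_add_distrib]
    linarith [hsum 1 (Or.inl rfl) alg K, hsum (-1) (Or.inr rfl) alg K]
  set q : ℝ := listTransitions s a s' l / n with hq
  have hq0 : 0 ≤ q := by positivity
  have hq1 : q ≤ 1 := by
    rw [hq, div_le_one hn']
    exact_mod_cast hvis ▸ listTransitions_le_listVisits s a s' l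
  have hfar : Real.sqrt (3 * lam * v) + lam / 2 < |p - q| := by
    by_contra! hle
    exact absurd (abs_sub_le_of_bernstein hp0 hp1 hq0 hq1 hlam0.le hle) (not_le.2 hdev)
  -- The product was frozen at the `n`-th visit, so at the end of the run it still shows the
  -- deviation present in `l`.
  have hval : ∀ e, stoppedProd s a n (f e) l' =
      Real.exp (n * (t * (e * (q - p)) - v * B)) := by
    intro e
    rw [stoppedProd_of_suffix s a n (f e) hl hvis.ge, stoppedProd_eq_exp s a s' n _ _ hvis.le, hvis]
    congr 1
    have : (listTransitions s a s' l : ℝ) = n * q := by rw [hq]; field_simp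
    rw [this]
    ring
  have hbig : ∀ e, Real.sqrt (3 * lam * v) + lam / 2 ≤ e * (q - p) →
      Real.exp (3 / 2 * L) ≤ stoppedProd s a n (f e) l' := by
    intro e he
    rw [hval, Real.exp_le_exp]
    have hL' : L = n * lam := by rw [hlam]; field_simp
    have h1 := mul_le_mul_of_nonneg_left he ht0
    calc 3 / 2 * L = n * (3 / 2 * lam) := by rw [hL']; ring
      _ ≤ _ := mul_le_mul_of_nonneg_left (by linarith) hn'.le
  rcases le_total p q with hpq | hpq
  · rw [abs_sub_comm, abs_of_nonneg (by linarith)] at hfar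
    linarith [hbig 1 (by linarith), hZ0 (-1) l']
  · rw [abs_of_nonneg (by linarith)] at hfar
    linarith [hbig (-1) (by linarith), hZ0 1 l']

/-- With a probability close to `1`, the true model is in all confidence sets. -/
theorem exists_confidence_weight (M : CMDP S A H) (K : ℕ) {L : ℝ} (hL : 1 / 2 ≤ L) :
    ∃ Z : (Fin K → Episode S A H) → ℝ, (∀ ω, 0 ≤ Z ω) ∧
      (∀ alg : Algorithm S A H, ∑ ω, runWeight M alg ω * Z ω ≤
        2 * (Fintype.card S ^ 2 * Fintype.card A * H * K) * Real.exp (-(3 / 2 * L))) ∧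
      ∀ ω, Z ω < 1 → ∀ k : Fin K, M.P ∈ confidenceSet L (past ω k) := by
  have hL0 : 0 < L := by linarith
  have hex := fun (s : S) (a : A) (s' : S) (n : ℕ) =>
    exists_bernstein_weight M s a s' (Nat.succ_pos n) hL0
  choose Z hZ0 hZsum hZ using hex
  -- The index `n` stands for `n + 1` visits; the count zero is treated separately.
  refine ⟨fun ω => ∑ s, ∑ a, ∑ s', ∑ n ∈ Finset.range (H * K),
      Real.exp (-(3 / 2 * L)) * Z s a s' n (historyList K ω),
    fun ω => ?_, fun alg => ?_, fun ω hω k s a s' => ?_⟩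
  · exact Finset.sum_nonneg fun s _ => Finset.sum_nonneg fun a _ => Finset.sum_nonneg fun s' _ =>
      Finset.sum_nonneg fun n _ => mul_nonneg (Real.exp_pos _).le (hZ0 _ _ _ _ _)
  · calc _ = ∑ s, ∑ a, ∑ s', ∑ n ∈ Finset.range (H * K), Real.exp (-(3 / 2 * L)) *
          ∑ ω : Fin K → Episode S A H, runWeight M alg ω * Z s a s' n (historyList K ω) := by
          simp_rw [Finset.mul_sum]
          rw [Finset.sum_comm]
          refine Finset.sum_congr rfl fun s _ => ?_
          rw [Finset.sum_comm]
          refine Finset.sum_congr rfl fun a _ => ?_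
          rw [Finset.sum_comm]
          refine Finset.sum_congr rfl fun s' _ => ?_
          rw [Finset.sum_comm]
          refine Finset.sum_congr rfl fun n _ => Finset.sum_congr rfl fun ω _ => ?_
          ring
      _ ≤ ∑ _s : S, ∑ _a : A, ∑ _s' : S, ∑ _n ∈ Finset.range (H * K),
          Real.exp (-(3 / 2 * L)) * 2 := by
          refine Finset.sum_le_sum fun s _ => Finset.sum_le_sum fun a _ =>
            Finset.sum_le_sum fun s' _ => Finset.sum_le_sum fun n _ =>
            mul_le_mul_of_nonneg_left (hZsum s a s' n alg K) (Real.exp_pos _).le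
      _ = _ := by
          simp
          ring
  · set N := visits (past ω k) s a with hN
    set T := transitions (past ω k) s a s' with hT
    have hTN : T ≤ N := transitions_le_visits _ _ _ _
    rcases Nat.eq_zero_or_pos N with h0 | hpos
    -- Without visits the empirical probability is 0 and the radius is `14 L / 3`, which exceeds 1
    -- because `1 / 2 ≤ L`.
    · have hT0 : T = 0 := by omega
      have hp0 := M.P.nonneg s a s'
      have hp1 := M.P.prob_le_one s a s'
      simp only [beta, empModel, ← hN, ← hT, h0, hT0]
      simp only [Nat.cast_zero, zero_div, sub_zero, zero_mul, mul_zero, Real.sqrt_zero]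
      rw [abs_of_nonneg hp0]
      norm_num
      linarith
    · by_contra hcon
      have hmax : max N 1 = N := by omega
      simp only [beta, empModel, ← hN, ← hT, hmax, not_le] at hcon
      have hk : (k : ℕ) + 1 ≤ K := k.isLt
      have hNK : N ≤ H * K := (visits_le _ _ _).trans (Nat.mul_le_mul_left _ (by omega))
      have hsuc : N - 1 + 1 = N := by omega
      have hNr : (0 : ℝ) < N := by exact_mod_cast hpos
      have hexp := hZ s a s' (N - 1) (historyList k (past ω k)) (historyList K ω)
        (historyList_suffix ω k.isLt.le) (by rw [listVisits_historyList]; omega)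
      rw [listTransitions_historyList, ← hT, Nat.succ_eq_add_one, hsuc] at hexp
      have hexp := hexp (by
        refine lt_of_eq_of_lt ?_ hcon
        congr 1
        · congr 1
          ring
        · field_simp)
      have hterm : 1 ≤ Real.exp (-(3 / 2 * L)) * Z s a s' (N - 1) (historyList K ω) := by
        calc (1 : ℝ) = Real.exp (-(3 / 2 * L)) * Real.exp (3 / 2 * L) := by
              rw [← Real.exp_add]; simp
          _ ≤ _ := mul_le_mul_of_nonneg_left hexp (Real.exp_pos _).le
      have hnn : ∀ s a s' n, 0 ≤ Real.exp (-(3 / 2 * L)) * Z s a s' n (historyList K ω) :=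
        fun s a s' n => mul_nonneg (Real.exp_pos _).le (hZ0 _ _ _ _ _)
      have h1 := Finset.single_le_sum (f := fun n => Real.exp (-(3 / 2 * L)) *
        Z s a s' n (historyList K ω)) (fun n _ => hnn s a s' n)
        (Finset.mem_range.2 (show N - 1 < H * K by omega))
      have h2 := Finset.single_le_sum (f := fun s' => ∑ n ∈ Finset.range (H * K),
        Real.exp (-(3 / 2 * L)) * Z s a s' n (historyList K ω))
        (fun s' _ => Finset.sum_nonneg fun n _ => hnn s a s' n) (Finset.mem_univ s')
      have h3 := Finset.single_le_sum (f := fun a => ∑ s', ∑ n ∈ Finset.range (H * K),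
        Real.exp (-(3 / 2 * L)) * Z s a s' n (historyList K ω))
        (fun a _ => Finset.sum_nonneg fun s' _ => Finset.sum_nonneg fun n _ => hnn s a s' n)
        (Finset.mem_univ a)
      have h4 := Finset.single_le_sum (f := fun s => ∑ a, ∑ s', ∑ n ∈ Finset.range (H * K),
        Real.exp (-(3 / 2 * L)) * Z s a s' n (historyList K ω))
        (fun s _ => Finset.sum_nonneg fun a _ => Finset.sum_nonneg fun s' _ =>
          Finset.sum_nonneg fun n _ => hnn s a s' n) (Finset.mem_univ s)
      simp only at h1 h2 h3 h4 hω
      linarith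

end Concentration

/-! ### Lower bound for the visits in the baseline episodes -/

section BaselineVisits

variable {S A : Type*} [Fintype S] [Fintype A] [DecidableEq S] [DecidableEq A] {H : ℕ}

theorem trajExp_episodeVisits (P : Model S A) (s₁ : S) (π : Policy S A H) (s : S) (a : A) :
    trajExp P s₁ π (episodeVisits s a) = ∑ h, occupancy P s₁ π h s a := by
  simp only [occupancy_eq_trajExp]
  rw [← trajExp_sum]
  rfl

/-- Indeed `exp (-x) ≤ 1 / (1 + x)`, and `(1 + x) (1 - x / 2) ≥ 1` on the unit interval. -/
theorem exp_neg_le_one_sub_half {x : ℝ} (h₀ : 0 ≤ x) (h₁ : x ≤ 1) :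
    Real.exp (-x) ≤ 1 - x / 2 := by
  have h := Real.add_one_le_exp x
  have h2 : Real.exp (-x) * Real.exp x = 1 := by rw [← Real.exp_add]; simp
  have h3 := Real.exp_pos (-x)
  nlinarith [mul_nonneg h₀ (sub_nonneg.2 h₁), mul_le_mul_of_nonneg_left h h3.le]

/-- The number of visits in an episode divided by `H` lies in the unit interval. There `exp (-x) ≤ 1
- x / 2`, so only the mean matters: the expectation of `exp (-visits / H)` is at most `1 - w / (2 H)
≤ exp (-w / (2 H))`. The loss of a factor 2 in the mean replaces a variance bound. -/
theorem trajExp_exp_neg_visits_le (hH : 0 < H) (P : Model S A) (s₁ : S) (π : Policy S A H)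
    (s : S) (a : A) :
    trajExp P s₁ π (fun τ =>
      Real.exp (((∑ h, occupancy P s₁ π h s a) / 2 - episodeVisits s a τ) / H)) ≤ 1 := by
  have hH' : (0 : ℝ) < H := by exact_mod_cast hH
  set w := ∑ h, occupancy P s₁ π h s a with hw
  have h1 : ∀ τ : Episode S A H, Real.exp ((w / 2 - episodeVisits s a τ) / H) ≤
      Real.exp (w / (2 * H)) * (1 + (-(1 / (2 * H))) * episodeVisits s a τ) := by
    intro τ
    have : (w / 2 - episodeVisits s a τ) / H = w / (2 * H) + -(episodeVisits s a τ / H) := by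
      field_simp
      ring
    rw [this, Real.exp_add]
    refine mul_le_mul_of_nonneg_left ?_ (Real.exp_pos _).le
    refine (exp_neg_le_one_sub_half (div_nonneg (episodeVisits_nonneg s a τ) hH'.le)
      ((div_le_one hH').2 (episodeVisits_le s a τ))).trans (le_of_eq ?_)
    field_simp
    ring
  refine (trajExp_mono P s₁ π h1).trans ?_
  rw [trajExp_const_mul, trajExp_add, trajExp_const, trajExp_const_mul, trajExp_episodeVisits, ← hw]
  calc _ ≤ Real.exp (w / (2 * H)) * Real.exp (-(w / (2 * H))) := by
        refine mul_le_mul_of_nonneg_left ?_ (Real.exp_pos _).le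
        have := Real.add_one_le_exp (-(w / (2 * H)))
        refine le_of_eq_of_le ?_ this
        ring
    _ = 1 := by rw [← Real.exp_add]; simp

theorem sum_runWeight_mul_baseline_le (hH : 0 < H) (M : CMDP S A H) (alg : Algorithm S A H)
    (π : Policy S A H) (m : ℕ) (halg : ∀ j < m, ∀ hist, alg j hist = π) (K : ℕ) (s : S) (a : A) :
    ∑ ω : Fin K → Episode S A H, runWeight M alg ω *
      ∏ j : Fin K, (if (j : ℕ) < m then Real.exp (((∑ h, occupancy M.P M.s₁ π h s a) / 2 -
        episodeVisits s a (ω j)) / H) else 1) ≤ 1 := by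
  set f : Episode S A H → ℝ := fun τ =>
    Real.exp (((∑ h, occupancy M.P M.s₁ π h s a) / 2 - episodeVisits s a τ) / H) with hf
  have hf0 : ∀ τ, 0 ≤ f τ := fun τ => (Real.exp_pos _).le
  have := sum_runWeight_mul_le M alg
    (fun n hist => ∏ j : Fin n, if (j : ℕ) < m then f (hist j) else 1) (fun n hist => ?_) K
  · simpa using this
  · simp only [Fin.prod_univ_castSucc, Fin.snoc_castSucc, Fin.snoc_last, Fin.val_castSucc,
      Fin.val_last]
    rw [trajExp_const_mul]
    refine mul_le_of_le_one_right
      (Finset.prod_nonneg fun j _ => by split_ifs; exacts [hf0 _, zero_le_one]) ?_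
    split_ifs with h
    · rw [halg n h]
      exact trajExp_exp_neg_visits_le hH M.P M.s₁ π s a
    · rw [trajExp_const]

/-- With a probability close to `1`, the baseline episodes visit every state-action pair at least
about half as often as expected. -/
theorem exists_visits_weight (hH : 0 < H) (M : CMDP S A H) (π : Policy S A H) (m K : ℕ) (L : ℝ) :
    ∃ Z : (Fin K → Episode S A H) → ℝ, (∀ ω, 0 ≤ Z ω) ∧
      (∀ alg : Algorithm S A H, (∀ j < m, ∀ hist, alg j hist = π) →
        ∑ ω, runWeight M alg ω * Z ω ≤ Fintype.card S * Fintype.card A * Real.exp (-L)) ∧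
      ∀ ω, Z ω < 1 → ∀ k : Fin K, m ≤ k → ∀ s a,
        m * (∑ h, occupancy M.P M.s₁ π h s a) / 2 - H * L ≤ visits (past ω k) s a := by
  have hH' : (0 : ℝ) < H := by exact_mod_cast hH
  set w : S → A → ℝ := fun s a => ∑ h, occupancy M.P M.s₁ π h s a with hw
  let G : S → A → (Fin K → Episode S A H) → ℝ := fun s a ω => ∏ j : Fin K,
    (if (j : ℕ) < m then Real.exp ((w s a / 2 - episodeVisits s a (ω j)) / H) else 1)
  have hG0 : ∀ s a ω, 0 ≤ G s a ω := fun s a ω => Finset.prod_nonneg fun j _ => by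
    split_ifs
    exacts [(Real.exp_pos _).le, zero_le_one]
  have hnn : ∀ s a ω, 0 ≤ Real.exp (-L) * G s a ω := fun s a ω =>
    mul_nonneg (Real.exp_pos _).le (hG0 s a ω)
  refine ⟨fun ω => ∑ s, ∑ a, Real.exp (-L) * G s a ω, fun ω => ?_, fun alg halg => ?_,
    fun ω hω k hmk s a => ?_⟩
  · exact Finset.sum_nonneg fun s _ => Finset.sum_nonneg fun a _ => hnn s a ω
  · calc _ = ∑ s, ∑ a, Real.exp (-L) *
          ∑ ω : Fin K → Episode S A H, runWeight M alg ω * G s a ω := by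
          simp_rw [Finset.mul_sum]
          rw [Finset.sum_comm]
          refine Finset.sum_congr rfl fun s _ => ?_
          rw [Finset.sum_comm]
          refine Finset.sum_congr rfl fun a _ => Finset.sum_congr rfl fun ω _ => ?_
          ring
      _ ≤ ∑ _s : S, ∑ _a : A, Real.exp (-L) * 1 :=
          Finset.sum_le_sum fun s _ => Finset.sum_le_sum fun a _ =>
            mul_le_mul_of_nonneg_left (sum_runWeight_mul_baseline_le hH M alg π m halg K s a)
              (Real.exp_pos _).le
      _ = _ := by
          simp
          ring
  -- Only the first `m` factors are nontrivial, so the weight depends on the baseline episodes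
  -- alone.
  · have hGval : G s a ω = Real.exp ((m * w s a / 2 -
        ∑ j : Fin m, episodeVisits s a (ω (j.castLE (hmk.trans k.isLt.le)))) / H) := by
      have hmK : m ≤ K := hmk.trans k.isLt.le
      obtain ⟨d, rfl⟩ := Nat.exists_eq_add_of_le hmK
      simp only [G]
      rw [Fin.prod_univ_add]
      simp only [Fin.val_castAdd, Fin.is_lt, if_true, Fin.val_natAdd, Nat.not_lt.2,
        Nat.le_add_right, if_false, Finset.prod_const_one, mul_one]
      rw [← Real.exp_sum, ← Finset.sum_div, Finset.sum_sub_distrib]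
      congr 2
      simp only [Finset.sum_const, Finset.card_univ, Fintype.card_fin, nsmul_eq_mul]
      congr 1
      ring
    by_contra! hcon
    have hle := sum_episodeVisits_le_visits ω k hmk s a
    have hbig : 1 ≤ Real.exp (-L) * G s a ω := by
      rw [hGval, ← Real.exp_add]
      apply Real.one_le_exp
      have : L ≤ (m * w s a / 2 -
          ∑ j : Fin m, episodeVisits s a (ω (j.castLE (hmk.trans k.isLt.le)))) / H := by
        rw [le_div_iff₀ hH']
        simp only [hw]
        linarith
      linarith
    have h1 := Finset.single_le_sum (f := fun a => Real.exp (-L) * G s a ω)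
      (fun a _ => hnn s a ω) (Finset.mem_univ a)
    have h2 := Finset.single_le_sum (f := fun s => ∑ a, Real.exp (-L) * G s a ω)
      (fun s _ => Finset.sum_nonneg fun a _ => hnn s a ω) (Finset.mem_univ s)
    simp only at h1 h2 hω
    linarith

end BaselineVisits

/-! ### The expected bonus of the baseline policy -/

section Bonus

theorem sum_sqrt_le_sqrt_card_mul_sum {ι : Type*} [Fintype ι] {x : ι → ℝ} (hx : ∀ i, 0 ≤ x i) :
    ∑ i, Real.sqrt (x i) ≤ Real.sqrt (Fintype.card ι * ∑ i, x i) := by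
  apply Real.le_sqrt_of_sq_le
  refine sq_sum_le_card_mul_sum_sq.trans (le_of_eq ?_)
  rw [Finset.card_univ]
  congr 1
  exact Finset.sum_congr rfl fun i _ => Real.sq_sqrt (hx i)

variable {S A : Type*} [DecidableEq S] [DecidableEq A] {H : ℕ}

theorem empModel_nonneg {m : ℕ} (hist : Fin m → Episode S A H) (s : S) (a : A) (s' : S) :
    0 ≤ empModel hist s a s' := by
  unfold empModel
  positivity

variable [Fintype S]

theorem sum_transitions {m : ℕ} (hist : Fin m → Episode S A H) (s : S) (a : A) :
    ∑ s', transitions hist s a s' = visits hist s a := by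
  unfold transitions visits
  rw [Finset.sum_comm]
  refine Finset.sum_congr rfl fun j _ => ?_
  rw [Finset.sum_comm]
  refine Finset.sum_congr rfl fun h _ => ?_
  simp [ite_and]

theorem sum_empModel_le_one {m : ℕ} (hist : Fin m → Episode S A H) (s : S) (a : A) :
    ∑ s', empModel hist s a s' ≤ 1 := by
  unfold empModel
  rw [← Finset.sum_div, ← Nat.cast_sum, sum_transitions]
  exact div_le_one_of_le₀ (by exact_mod_cast le_max_left _ _) (by positivity)

/-- Drop the factor `1 - P̂` and apply Cauchy–Schwarz over the next states; the empirical
probabilities sum to at most 1, so only one `√S` is lost. -/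
theorem betaBar_le {L : ℝ} (hL : 0 ≤ L) {m : ℕ} (hist : Fin m → Episode S A H) (s : S) (a : A) :
    betaBar L hist s a ≤ 2 * Real.sqrt (L * Fintype.card S / (max (visits hist s a) 1 : ℕ)) +
      14 / 3 * (L * Fintype.card S) / (max (visits hist s a) 1 : ℕ) := by
  have hN : (0 : ℝ) < (max (visits hist s a) 1 : ℕ) := by
    exact_mod_cast lt_of_lt_of_le one_pos (le_max_right _ _)
  unfold betaBar beta
  generalize ((max (visits hist s a) 1 : ℕ) : ℝ) = N at hN ⊢
  rw [Finset.sum_add_distrib]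
  refine add_le_add ?_ (le_of_eq ?_)
  · have hle : ∀ s', Real.sqrt (4 * (empModel hist s a s' * (1 - empModel hist s a s')) * L / N) ≤
        Real.sqrt (4 * empModel hist s a s' * L / N) := by
      intro s'
      have h0 := empModel_nonneg hist s a s'
      apply Real.sqrt_le_sqrt
      gcongr
      nlinarith
    refine (Finset.sum_le_sum fun s' _ => hle s').trans ?_
    refine (sum_sqrt_le_sqrt_card_mul_sum fun s' => ?_).trans ?_
    · have h0 := empModel_nonneg hist s a s'
      positivity
    · rw [← Finset.sum_div, ← Finset.sum_mul, ← Finset.mul_sum]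
      rw [show (2 : ℝ) * Real.sqrt (L * Fintype.card S / N) =
        Real.sqrt (2 ^ 2 * (L * Fintype.card S / N)) by
          rw [Real.sqrt_mul (by norm_num), Real.sqrt_sq (by norm_num)]]
      apply Real.sqrt_le_sqrt
      calc _ = (∑ s', empModel hist s a s') * (4 * (L * Fintype.card S / N)) := by ring
        _ ≤ 1 * (4 * (L * Fintype.card S / N)) := by
          gcongr
          exact sum_empModel_le_one hist s a
        _ = _ := by ring
  · simp
    field_simp

/-- A bonus that decreases with the number `N` of visits, weighted with the expected number `w` of
visits in an episode, if `N` is comparable with the expected number of visits in `m` episodes. -/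
theorem mul_bonus_le {w N Q L h m : ℝ} (hw : 0 ≤ w) (hN : 1 ≤ N) (hQ : 1 ≤ Q)
    (hL : 1 / 2 ≤ L) (hh : 1 ≤ h) (hm : 0 < m) (hvis : m * w / 2 - h * L ≤ N) :
    w * (2 * Real.sqrt (L * Q / N) + 14 / 3 * (L * Q) / N) ≤
      4 * Real.sqrt (L * Q / m * w) + 44 * (L ^ 2 * Q * h / m) := by
  have hLQ : 1 / 2 ≤ L * Q := by nlinarith
  have hLh : 1 / 2 ≤ h * L := by nlinarith
  have hN0 : 0 < N := by linarith
  have h1 : w * Real.sqrt (L * Q / N) ≤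
      2 * Real.sqrt (L * Q / m * w) + 8 * (L ^ 2 * Q * h / m) := by
    have hnn : 0 ≤ L ^ 2 * Q * h / m := by positivity
    -- If `N` dominates the correction `h L`, then `w ≤ 4 N / m` and one factor `w` cancels against
    -- `N` under the root. Otherwise `w ≤ 4 h L / m` is itself of lower order, and the crude bound
    -- `√(L Q) ≤ 2 L Q` suffices.
    rcases le_total (h * L) N with hc | hc
    · have hwN : w ≤ 4 * N / m := by
        rw [le_div_iff₀ hm]
        linarith
      have : w * Real.sqrt (L * Q / N) ≤ 2 * Real.sqrt (L * Q / m * w) := by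
        rw [← Real.sqrt_sq hw, ← Real.sqrt_mul (sq_nonneg w), Real.sqrt_sq hw,
          show (2 : ℝ) * Real.sqrt (L * Q / m * w) = Real.sqrt (2 ^ 2 * (L * Q / m * w)) by
            rw [Real.sqrt_mul (sq_nonneg (2 : ℝ)), Real.sqrt_sq zero_le_two]]
        apply Real.sqrt_le_sqrt
        calc w ^ 2 * (L * Q / N) = w * (L * Q / N) * w := by ring
          _ ≤ w * (L * Q / N) * (4 * N / m) := by gcongr
          _ = _ := by
            field_simp
            ring
      linarith
    · have hwm : w ≤ 4 * (h * L) / m := by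
        rw [le_div_iff₀ hm]
        linarith
      have hs : Real.sqrt (L * Q / N) ≤ 2 * (L * Q) := by
        rw [Real.sqrt_le_left (by positivity)]
        have : L * Q / N ≤ L * Q := div_le_self (by positivity) hN
        nlinarith
      have : w * Real.sqrt (L * Q / N) ≤ 4 * (h * L) / m * (2 * (L * Q)) := by gcongr
      have h2 : 4 * (h * L) / m * (2 * (L * Q)) = 8 * (L ^ 2 * Q * h / m) := by ring
      linarith [Real.sqrt_nonneg (L * Q / m * w)]
  have h2 : w * (14 / 3 * (L * Q) / N) ≤ 28 * (L ^ 2 * Q * h / m) := by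
    have hwN : w / N ≤ 6 * (h * L) / m := by
      rw [div_le_div_iff₀ hN0 hm]
      nlinarith
    calc w * (14 / 3 * (L * Q) / N) = 14 / 3 * (L * Q) * (w / N) := by ring
      _ ≤ 14 / 3 * (L * Q) * (6 * (h * L) / m) := by gcongr
      _ = _ := by ring
  linarith

variable [Fintype A]

/-- The expected bonus of the baseline policy is small once the baseline policy has been played in
sufficiently many episodes. -/
theorem sum_mul_betaBar_lt {w : S → A → ℝ} (hw : ∀ s a, 0 ≤ w s a)
    (hwH : ∑ s, ∑ a, w s a = H) {L : ℝ} (hL : 1 / 2 ≤ L) (hH : 1 ≤ H) {Δ m : ℝ} (hΔ : 0 < Δ)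
    (hΔH : Δ ≤ H) (hS : 1 ≤ Fintype.card S) (hm : 0 < m)
    (hm' : 512 * L ^ 2 * ((Fintype.card S : ℝ) ^ 2 * Fintype.card A * (H : ℝ) ^ 3 / Δ ^ 2) ≤ m)
    {k : ℕ} (hist : Fin k → Episode S A H)
    (hvis : ∀ s a, m * w s a / 2 - H * L ≤ visits hist s a) :
    H * ∑ s, ∑ a, w s a * betaBar L hist s a < Δ := by
  have hHr : (1 : ℝ) ≤ H := by exact_mod_cast hH
  have hSr : (1 : ℝ) ≤ Fintype.card S := by exact_mod_cast hS
  set Q : ℝ := ((Fintype.card S : ℕ) : ℝ) with hQ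
  set B : ℝ := ((Fintype.card A : ℕ) : ℝ) with hB
  have hB0 : 0 ≤ B := by positivity
  have hL0 : 0 < L := by linarith
  have h1 : ∀ s a, w s a * betaBar L hist s a ≤
      4 * Real.sqrt (L * Q / m * w s a) + 44 * (L ^ 2 * Q * H / m) := by
    intro s a
    have hN1 : (1 : ℝ) ≤ (max (visits hist s a) 1 : ℕ) := by exact_mod_cast le_max_right _ _
    have hNv : (visits hist s a : ℝ) ≤ (max (visits hist s a) 1 : ℕ) := by
      exact_mod_cast le_max_left _ _
    exact (mul_le_mul_of_nonneg_left (betaBar_le hL0.le hist s a) (hw s a)).trans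
      (mul_bonus_le (hw s a) hN1 hSr hL hHr hm ((hvis s a).trans hNv))
  have h2 : ∑ s, ∑ a, w s a * betaBar L hist s a ≤
      4 * Real.sqrt (Q * B * (L * Q / m * H)) + Q * B * (44 * (L ^ 2 * Q * H / m)) := by
    calc _ ≤ ∑ s, ∑ a, (4 * Real.sqrt (L * Q / m * w s a) + 44 * (L ^ 2 * Q * H / m)) :=
          Finset.sum_le_sum fun s _ => Finset.sum_le_sum fun a _ => h1 s a
      _ = 4 * ∑ x : S × A, Real.sqrt (L * Q / m * w x.1 x.2) +
          Q * B * (44 * (L ^ 2 * Q * H / m)) := by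
          simp only [Finset.sum_add_distrib, ← Finset.mul_sum, Fintype.sum_prod_type]
          simp only [Finset.sum_const, Finset.card_univ, nsmul_eq_mul, ← hQ, ← hB]
          ring
      _ ≤ _ := by
          gcongr
          -- Cauchy–Schwarz over the pairs `(s, a)`, whose weights sum to `H`.
          refine (sum_sqrt_le_sqrt_card_mul_sum fun x => ?_).trans (le_of_eq ?_)
          · have := hw x.1 x.2
            positivity
          · rw [← Finset.mul_sum, Fintype.sum_prod_type, hwH, Fintype.card_prod]
            push_cast
            rfl
  set X := Q ^ 2 * B * (H : ℝ) ^ 3 / Δ ^ 2 with hX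
  have hX0 : 0 ≤ X := by positivity
  have hXe : Q ^ 2 * B * (H : ℝ) ^ 3 = X * Δ ^ 2 := by rw [hX]; field_simp
  have hL2X : L ^ 2 * X / m ≤ 1 / 512 := by
    rw [div_le_iff₀ hm]
    linarith
  -- The main term enters with the factor 4 and uses `Δ / 4`; the lower-order term uses `44 / 512 *
  -- Δ`. Together they stay below `Δ`.
  have hsq : H * Real.sqrt (Q * B * (L * Q / m * H)) ≤ Δ / 16 := by
    rw [← Real.sqrt_sq (show (0 : ℝ) ≤ H by linarith), ← Real.sqrt_mul (sq_nonneg _),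
      Real.sqrt_sq (by linarith), Real.sqrt_le_left (by positivity)]
    calc (H : ℝ) ^ 2 * (Q * B * (L * Q / m * H)) = L * (Q ^ 2 * B * (H : ℝ) ^ 3) / m := by ring
      _ = L * X / m * Δ ^ 2 := by rw [hXe]; ring
      _ ≤ 1 / 256 * Δ ^ 2 := by
          refine mul_le_mul_of_nonneg_right ?_ (sq_nonneg Δ)
          have : L * X / m ≤ 2 * (L ^ 2 * X / m) := by
            have h3 : L * X ≤ 2 * (L ^ 2 * X) := by nlinarith [mul_nonneg hL0.le hX0]
            calc L * X / m ≤ 2 * (L ^ 2 * X) / m := div_le_div_of_nonneg_right h3 hm.le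
              _ = _ := mul_div_assoc _ _ _
          linarith
      _ = _ := by ring
  have hlow : H * (Q * B * (44 * (L ^ 2 * Q * H / m))) ≤ 44 / 512 * Δ := by
    have h3 : (H : ℝ) * (Q * B * (44 * (L ^ 2 * Q * H / m))) =
        44 * (L ^ 2 * X / m) * (Δ ^ 2 / H) := by
      have : Q ^ 2 * B * (H : ℝ) ^ 2 = X * (Δ ^ 2 / H) := by
        have hH0 : (H : ℝ) ≠ 0 := by linarith
        rw [mul_div_assoc', ← hXe]
        field_simp
      calc _ = 44 * (L ^ 2 * (Q ^ 2 * B * (H : ℝ) ^ 2) / m) := by ring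
        _ = _ := by rw [this]; ring
    -- Here `Δ ≤ H` is needed: it turns the quadratic bound on the lower-order term into a linear
    -- one.
    have h4 : Δ ^ 2 / H ≤ Δ := by
      rw [div_le_iff₀ (by linarith)]
      nlinarith
    rw [h3]
    calc _ ≤ 44 * (1 / 512) * Δ := by gcongr
      _ = _ := by ring
  have h5 := mul_le_mul_of_nonneg_left h2 (show (0 : ℝ) ≤ H by linarith)
  rw [mul_add] at h5
  nlinarith

end Bonus

/-! ### The logarithmic factor and the total failure probability -/

section Arithmetic

variable {Q B H K δ : ℝ}

theorem half_le_log (hQ : 1 ≤ Q) (hB : 1 ≤ B) (hH : 1 ≤ H) (hK : 1 ≤ K) (hδ₀ : 0 < δ)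
    (hδ₁ : δ ≤ 1) : 1 / 2 ≤ Real.log (2 * Q * B * H * K / δ) := by
  have h : 2 ≤ 2 * Q * B * H * K / δ := by
    rw [le_div_iff₀ hδ₀]
    calc 2 * δ ≤ 2 * 1 := by gcongr
      _ ≤ 2 * (Q * B * H * K) := by
        gcongr
        exact one_le_mul_of_one_le_of_one_le (one_le_mul_of_one_le_of_one_le
          (one_le_mul_of_one_le_of_one_le hQ hB) hH) hK
      _ = _ := by ring
  have := Real.log_le_log (by norm_num) h
  linarith [Real.log_two_gt_d9]

/-- Let `R = exp L`. The union over `(s, a, s', n)` has a factor `S` more than the argument of `L`.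
The exponent `3/2` instead of 1 pays for it: the extra `R^(-1/2)` absorbs `S` because `S² ≤ R`,
which follows from `S ≤ K`. Each of the two summands is then at most `δ`. -/
theorem failure_probability_le (hQ : 1 ≤ Q) (hB : 1 ≤ B) (hH : 1 ≤ H) (hK : 1 ≤ K)
    (hQK : Q ≤ K) (hδ₀ : 0 < δ) (hδ₁ : δ ≤ 1) :
    2 * (Q ^ 2 * B * H * K) * Real.exp (-(3 / 2 * Real.log (2 * Q * B * H * K / δ))) +
      Q * B * Real.exp (-Real.log (2 * Q * B * H * K / δ)) ≤ 2 * δ := by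
  set R := 2 * Q * B * H * K / δ with hR
  have hR0 : 0 < R := by positivity
  have hRδ : R * δ = 2 * Q * B * H * K := by rw [hR]; field_simp
  set y := Real.exp (-(1 / 2 * Real.log R)) with hy
  have hy0 : 0 < y := Real.exp_pos _
  have hyy : Real.exp (-Real.log R) = y * y := by
    rw [hy, ← Real.exp_add]
    congr 1
    ring
  have hyyy : Real.exp (-(3 / 2 * Real.log R)) = y * y * y := by
    rw [hy, ← Real.exp_add, ← Real.exp_add]
    congr 1
    ring
  have hyR : y * y * R = 1 := by
    rw [← hyy, Real.exp_neg, Real.exp_log hR0, inv_mul_cancel₀ hR0.ne']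
  have hQB : Q * B ≤ R * δ := by
    have h1 : 1 ≤ H * K := one_le_mul_of_one_le_of_one_le hH hK
    have h2 : 0 ≤ Q * B := by positivity
    calc Q * B ≤ Q * B * (2 * (H * K)) := le_mul_of_one_le_right h2 (by linarith)
      _ = R * δ := by rw [hRδ]; ring
  have hQR : Q ^ 2 ≤ R := by
    have h1 : 1 ≤ B * H := one_le_mul_of_one_le_of_one_le hB hH
    have h2 : 0 ≤ Q * K := by positivity
    calc Q ^ 2 = Q * Q := by ring
      _ ≤ Q * K := by gcongr
      _ ≤ Q * K * (2 * (B * H)) := le_mul_of_one_le_right h2 (by linarith)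
      _ = R * δ := by rw [hRδ]; ring
      _ ≤ R := mul_le_of_le_one_right hR0.le hδ₁
  have hQy : Q * y ≤ 1 := by
    have h1 : (Q * y) ^ 2 ≤ 1 ^ 2 := by
      calc (Q * y) ^ 2 = y * y * Q ^ 2 := by ring
        _ ≤ y * y * R := by gcongr
        _ = 1 ^ 2 := by rw [hyR, one_pow]
    exact (pow_le_pow_iff_left₀ (by positivity) zero_le_one two_ne_zero).1 h1
  have h1 : 2 * (Q ^ 2 * B * H * K) * (y * y * y) ≤ δ := by
    calc _ = y * y * (2 * Q * B * H * K) * (Q * y) := by ring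
      _ = y * y * R * δ * (Q * y) := by rw [← hRδ]; ring
      _ = δ * (Q * y) := by rw [hyR, one_mul]
      _ ≤ δ := mul_le_of_le_one_right hδ₀.le hQy
  have h2 : Q * B * (y * y) ≤ δ := by
    calc Q * B * (y * y) ≤ R * δ * (y * y) := by gcongr
      _ = y * y * R * δ := by ring
      _ = δ := by rw [hyR, one_mul]
  rw [hyy, hyyy]
  linarith

end Arithmetic

/-! ### Mixing a policy with slack -/

section Feasibility

variable {S A : Type*} [Fintype S] [Fintype A] [DecidableEq S] {H : ℕ}

theorem value_add_mul (P : Model S A) (s₁ : S) (π : Policy S A H) (l₁ l₂ : S → A → ℝ) (x : ℝ) :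
    value P s₁ π (fun s a => l₁ s a + x * l₂ s a) =
      value P s₁ π l₁ + x * value P s₁ π l₂ := by
  simp only [value_eq_sum_occupancy, mul_add, Finset.sum_add_distrib, Finset.mul_sum]
  congr 1
  refine Finset.sum_congr rfl fun h _ => Finset.sum_congr rfl fun s _ =>
    Finset.sum_congr rfl fun a _ => ?_
  ring

/-- A policy with slack for the pessimistic cost can be mixed with any other policy so that the
constraint still holds. -/
theorem exists_mixture_value_le (P : Model S A) (s₁ : S) (π₀ π₁ : Policy S A H) (l : S → A → ℝ)
    {C : ℝ} (h₀ : value P s₁ π₀ l < C) :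
    ∃ π : Policy S A H, value P s₁ π l ≤ C ∧
      (∀ s a h, 0 < occupancy P s₁ π₁ h s a → 0 < occupancy P s₁ π h s a) ∧
      ∃ α ∈ Set.Ioo (0 : ℝ) 1, ∀ s a h, occupancy P s₁ π h s a =
        (1 - α) * occupancy P s₁ π₀ h s a + α * occupancy P s₁ π₁ h s a := by
  set g := C - value P s₁ π₀ l with hg
  set D := |value P s₁ π₁ l - C| with hD
  have hg0 : 0 < g := by linarith
  have hD0 : 0 ≤ D := abs_nonneg _
  have hDle : value P s₁ π₁ l - C ≤ D := le_abs_self _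
  -- The mixture has value at most `C - g + α (g + D)`, which is at most `C` for this `α`; the
  -- summand 1 makes `α < 1` even when `D = 0`.
  set α := g / (g + D + 1) with hα
  have hα0 : 0 < α := by positivity
  have hα1 : α < 1 := by rw [hα, div_lt_one (by positivity)]; linarith
  obtain ⟨π, hπ⟩ := exists_policy_occupancy_convex P s₁ π₀ π₁ hα0.le hα1.le
  refine ⟨π, ?_, fun s a h hpos => ?_, α, ⟨hα0, hα1⟩, hπ⟩
  · have hval : value P s₁ π l = (1 - α) * value P s₁ π₀ l + α * value P s₁ π₁ l := by
      simp only [value_eq_sum_occupancy, hπ, Finset.mul_sum, ← Finset.sum_add_distrib]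
      refine Finset.sum_congr rfl fun h _ => Finset.sum_congr rfl fun s _ =>
        Finset.sum_congr rfl fun a _ => ?_
      ring
    have h1 : α * (g + D + 1) = g := by rw [hα]; field_simp
    have h2 := mul_le_mul_of_nonneg_left hDle hα0.le
    rw [hval]
    nlinarith
  · rw [hπ]
    have := mul_nonneg (sub_nonneg.2 hα1.le) (occupancy_nonneg P s₁ π₀ h s a)
    have := mul_pos hα0 hpos
    linarith

end Feasibility

end OPSRL

/-! ### The main theorem -/

theorem corollary1 :
    ∃ (C : ℝ) (p : ℕ), 0 < C ∧
      ∀ (S A : Type*) [Fintype S] [Fintype A] [DecidableEq S] [DecidableEq A]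
        (H K K₀ : ℕ) (M : OPSRL.CMDP S A H) (δ : ℝ), 0 < δ → δ < 1 →
      ∀ (πb πstar : OPSRL.Policy S A H) (Cb : ℝ),
        OPSRL.value M.P M.s₁ πb M.c = Cb → Cb < M.Cbar → M.Cbar - Cb ≤ H →
        OPSRL.IsOptimalSafe M πstar →
        C * OPSRL.logTerm S A H K δ ^ p *
          ((Fintype.card S : ℝ) ^ 2 * Fintype.card A * (H : ℝ) ^ 3 / (M.Cbar - Cb) ^ 2) ≤ K₀ →
      ∀ alg : OPSRL.Algorithm S A H,
        OPSRL.IsOPSRL M πb Cb (OPSRL.logTerm S A H K δ) K₀ alg →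
        1 - 3 * δ ≤ OPSRL.runProb M alg
          {ω : Fin K → OPSRL.Episode S A H | ∀ k : Fin K, K₀ ≤ (k : ℕ) + 1 →
            ∃ π' : OPSRL.Policy S A H,
              (π', M.P) ∈ OPSRL.opFeasible M (OPSRL.logTerm S A H K δ) (OPSRL.past ω k) ∧
              (∀ (s : S) (a : A) (h : Fin H),
                0 < OPSRL.occupancy M.P M.s₁ πstar h s a →
                  0 < OPSRL.occupancy M.P M.s₁ π' h s a) ∧
              ∃ α ∈ Set.Ioo (0 : ℝ) 1, ∀ (s : S) (a : A) (h : Fin H),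
                OPSRL.occupancy M.P M.s₁ π' h s a =
                  (1 - α) * OPSRL.occupancy M.P M.s₁ πb h s a +
                    α * OPSRL.occupancy M.P M.s₁ πstar h s a} := by
  -- Twice the constant 512 of `sum_mul_betaBar_lt`: only `K₀ - 1` baseline episodes precede episode
  -- `K₀`, and `K₀ - 1 ≥ K₀ / 2`. The power 2 of `L` comes from the lower-order terms.
  refine ⟨1024, 2, by norm_num, ?_⟩
  intro S A _ _ _ _ H K K₀ M δ hδ0 hδ1 πb πstar Cb hCb hCbar hCH _ hK₀ alg halg
  -- For `K < K₀` no episode is concerned, so the event is everything and the weight 0 suffices.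
  rcases Nat.lt_or_ge K K₀ with hKK | hKK
  · refine le_trans ?_ (OPSRL.one_sub_le_runProb M alg (Z := fun _ => 0) (b := 0)
      (fun _ => le_rfl) (fun ω hω => absurd (fun k hk => ?_) hω) (by simp))
    · linarith
    · exact absurd hk (by have := k.isLt; omega)
  rcases Nat.eq_zero_or_pos K with hK0 | hKpos
  · subst hK0
    refine le_trans ?_ (OPSRL.one_sub_le_runProb M alg (Z := fun _ => 0) (b := 0)
      (fun _ => le_rfl) (fun ω hω => absurd (fun k _ => k.elim0) hω) (by simp))
    linarith
  set Δ := M.Cbar - Cb with hΔ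
  have hΔ0 : 0 < Δ := by linarith
  have hHr0 : (0 : ℝ) < H := by linarith
  have hH : 0 < H := by exact_mod_cast hHr0
  have : Nonempty S := ⟨M.s₁⟩
  have hS : 1 ≤ Fintype.card S := Fintype.card_pos
  have hA : 1 ≤ Fintype.card A := by
    rcases isEmpty_or_nonempty A with hA | hA
    · have := πb.sum_eq_one ⟨0, hH⟩ M.s₁
      simp at this
    · exact Fintype.card_pos
  have hSr : (1 : ℝ) ≤ Fintype.card S := by exact_mod_cast hS
  have hAr : (1 : ℝ) ≤ Fintype.card A := by exact_mod_cast hA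
  have hHr : (1 : ℝ) ≤ H := by exact_mod_cast hH
  have hKr : (1 : ℝ) ≤ K := by exact_mod_cast hKpos
  set Q : ℝ := ((Fintype.card S : ℕ) : ℝ) with hQ
  set B : ℝ := ((Fintype.card A : ℕ) : ℝ) with hB
  set L := OPSRL.logTerm S A H K δ with hLdef
  have hL : 1 / 2 ≤ L := OPSRL.half_le_log hSr hAr hHr hKr hδ0 hδ1.le
  set X := Q ^ 2 * B * (H : ℝ) ^ 3 / Δ ^ 2 with hX
  have hXQ : Q ^ 2 ≤ X := by
    rw [hX, le_div_iff₀ (by positivity)]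
    have h1 : Δ ^ 2 ≤ (H : ℝ) ^ 2 := pow_le_pow_left₀ hΔ0.le hCH 2
    have h2 : (H : ℝ) ^ 2 ≤ (H : ℝ) ^ 3 := pow_le_pow_right₀ hHr (by norm_num)
    calc Q ^ 2 * Δ ^ 2 ≤ Q ^ 2 * (1 * (H : ℝ) ^ 3) := by
          gcongr
          linarith
      _ ≤ Q ^ 2 * (B * (H : ℝ) ^ 3) := by gcongr
      _ = _ := by ring
  have hL2 : 1 / 4 ≤ L ^ 2 := by nlinarith
  -- This yields `K₀ ≥ 2` and, with `K₀ ≤ K`, the bound `S ≤ K` needed for the failure probability.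
  have hK₀Q : 256 * Q ^ 2 ≤ K₀ := by
    have : 1 / 4 * Q ^ 2 ≤ L ^ 2 * X := by gcongr
    linarith
  have hK₀2 : (2 : ℝ) ≤ K₀ := by nlinarith
  have hK₀n : 2 ≤ K₀ := by exact_mod_cast hK₀2
  obtain ⟨m, rfl⟩ : ∃ m, K₀ = m + 1 := ⟨K₀ - 1, by omega⟩
  push_cast at hK₀ hK₀2 hK₀Q
  obtain ⟨Z₁, hZ₁0, hZ₁sum, hZ₁⟩ := OPSRL.exists_confidence_weight M K hL
  obtain ⟨Z₂, hZ₂0, hZ₂sum, hZ₂⟩ := OPSRL.exists_visits_weight hH M πb m K L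
  have hZ₁' := hZ₁sum alg
  have hZ₂' := hZ₂sum alg fun j hj hist => (halg j hist).1 (by omega)
  have hQK : Q ≤ K := by
    have : ((m + 1 : ℕ) : ℝ) ≤ K := by exact_mod_cast hKK
    push_cast at this
    nlinarith
  have hfail := OPSRL.failure_probability_le hSr hAr hHr hKr hQK hδ0 hδ1.le
  -- A run with `Z₁ + Z₂ < 1` is good for both reasons at once. The total weight is at most `2 δ`,
  -- within the allowed `3 δ`.
  refine le_trans ?_ (OPSRL.one_sub_le_runProb M alg (Z := fun ω => Z₁ ω + Z₂ ω) (b := 2 * δ)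
    (fun ω => add_nonneg (hZ₁0 ω) (hZ₂0 ω)) (fun ω hω => ?_) ?_)
  · linarith
  · by_contra! hlt
    refine hω fun k hk => ?_
    have hconf := hZ₁ ω (by linarith [hZ₂0 ω]) k
    have hvis := hZ₂ ω (by linarith [hZ₁0 ω]) k (by omega)
    set w : S → A → ℝ := fun s a => ∑ h, OPSRL.occupancy M.P M.s₁ πb h s a with hw
    have hm0 : (0 : ℝ) < m := by linarith
    have hbonus := OPSRL.sum_mul_betaBar_lt (w := w)
      (fun s a => Finset.sum_nonneg fun h _ => OPSRL.occupancy_nonneg _ _ _ _ _ _)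
      (by
        have : ∀ s, ∑ a, w s a = ∑ h, ∑ a, OPSRL.occupancy M.P M.s₁ πb h s a :=
          fun s => Finset.sum_comm
        simp only [this]
        rw [Finset.sum_comm]
        simp [OPSRL.sum_sum_occupancy])
      hL hH hΔ0 hCH hS hm0 (by linarith) (OPSRL.past ω k) hvis
    have hval : ∑ s, ∑ a, w s a * OPSRL.betaBar L (OPSRL.past ω k) s a =
        OPSRL.value M.P M.s₁ πb (OPSRL.betaBar L (OPSRL.past ω k)) := by
      rw [OPSRL.value_eq_sum_occupancy, Finset.sum_comm]
      simp only [hw, Finset.sum_mul]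
      rw [Finset.sum_comm]
      refine Eq.trans ?_ Finset.sum_comm
      refine Finset.sum_congr rfl fun s _ => ?_
      exact Finset.sum_comm
    have hslack : OPSRL.value M.P M.s₁ πb (OPSRL.pessCost M L (OPSRL.past ω k)) < M.Cbar := by
      have : OPSRL.value M.P M.s₁ πb (OPSRL.pessCost M L (OPSRL.past ω k)) =
          OPSRL.value M.P M.s₁ πb M.c +
            H * OPSRL.value M.P M.s₁ πb (OPSRL.betaBar L (OPSRL.past ω k)) :=
        OPSRL.value_add_mul _ _ _ _ _ _
      rw [this, hCb, ← hval]
      linarith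
    obtain ⟨π', h1, h2⟩ := OPSRL.exists_mixture_value_le M.P M.s₁ πb πstar _ hslack
    exact ⟨π', ⟨hconf, h1⟩, h2⟩
  · simp only [mul_add, Finset.sum_add_distrib]
    exact (add_le_add hZ₁' hZ₂').trans hfail
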